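/- Let $\mathbb K$ be an algebraically closed field of characteristic different from $2$ and $3$. Let $B$ be the $\mathbb K$-algebra (the Nichols algebra of the tetrahedron rack with constant cocycle $-1$) presented by generators $a,b,c,d$ and relations $$a^2=b^2=c^2=d^2=0,\qquad (a+b+c)^6=0,$$ $$ab+bc+ca=ac+cd+da=ad+ba+db=bd+cb+dc=0,$$ graded by $\deg a=\deg b=\deg c=\deg d=1$. For $\alpha_1,\alpha_2,\alpha_3\in\mathbb K$ let $\mathcal T(\alpha_1,\alpha_2,\alpha_3)$ be the $\mathbb K$-algebra presented by generators $a,b,c,d$ and relations $$a^2=b^2=c^2=d^2=\alpha_1,\qquad ca+bc+ab=da+cd+ac=db+ba+ad=dc+cb+bd=\alpha_2,$$ $$(cb+ba+ac-\alpha_2)^3=\alpha_3,$$ and put $y=ac+cb+ba-\alpha_2\in\mathcal T(\alpha_1,\alpha_2,\alpha_3)$. Let $G$ be the group with generators $g_a,g_b,g_c,g_d$ and relations $$g_ag_b=g_bg_c=g_cg_a,\quad g_ag_c=g_cg_d=g_dg_a,\quad g_ag_d=g_dg_b=g_bg_a,\quad g_bg_d=g_dg_c=g_cg_b.$$ Then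 for all $\alpha_1,\alpha_2,\alpha_3\in\mathbb K$: 1. $G$ acts by algebra automorphisms on $B$ and on $\mathcal T(\alpha_1,\alpha_2,\alpha_3)$ in such a way that on the generators $g_a:(a,b,c,d)\mapsto(-a,-c,-d,-b)$, $g_b:(a,b,c,d)\mapsto(-d,-b,-a,-c)$, $g_c:(a,b,c,d)\mapsto(-b,-d,-c,-a)$, $g_d:(a,b,c,d)\mapsto(-c,-a,-b,-d)$; and $\mathcal T(\alpha_1,\alpha_2,\alpha_3)$, filtered by word length in $a,b,c,d$, is a PBW deformation of $B$ in the category of $\mathbb KG$-modules. That is, $B$ is a graded algebra and $\mathcal T(\alpha_1,\alpha_2,\alpha_3)$ a filtered algebra in this category, and the associated graded algebra $\mathrm{gr}\,\mathcal T(\alpha_1,\alpha_2,\alpha_3)$ is isomorphic to $B$ as a graded algebra, $G$-equivariantly. 2. The elements $$(b-a)^{n_1}a^{n_2}c^{n_3}y^{n_4}d^{n_5},\qquad n_1,n_4\in\{0,1,2\},\ n_2,n_3,n_5\in\{0,1\},$$ form a basis of $\mathcal T(\alpha_1,\alpha_2,\alpha_3)$. Moreover $\dim B=72$, and the Hilbert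 series of $B$ is $(1+t)^3(1+t+t^2)(1+t^2+t^4)$. -/

import Mathlib

open scoped DirectSum

/-! ### Filtered algebras and their associated graded algebras -/

/-- An exhaustive `ℕ`-filtration `F 0 ⊆ F 1 ⊆ ⋯` of a `K`-algebra `D` by subspaces, with
`1 ∈ F 0` and `F i * F j ⊆ F (i + j)`. -/
structure AlgFiltration (K D : Type*) [Field K] [Ring D] [Algebra K D] where
  F : ℕ → Submodule K D
  mono : Monotone F
  one_mem : (1 : D) ∈ F 0
  mul_mem : ∀ {i j : ℕ} {x y : D}, x ∈ F i → y ∈ F j → x * y ∈ F (i + j)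
  exhaustive : ∀ x : D, ∃ n, x ∈ F n

namespace AlgFiltration

variable {K D : Type*} [Field K] [Ring D] [Algebra K D] (f : AlgFiltration K D)

/-- The previous step of the filtration: `F (n - 1)`, with `F (-1) = 0`. -/
def low : ℕ → Submodule K D
  | 0 => ⊥
  | n + 1 => f.F n

theorem low_mul_mem {i j : ℕ} {x y : D} (hx : x ∈ f.low i) (hy : y ∈ f.F j) :
    x * y ∈ f.low (i + j) := by
  cases i with
  | zero =>
    have h : x = 0 := hx
    rw [h, zero_mul]
    exact Submodule.zero_mem _
  | succ i =>
    have h : i + 1 + j = (i + j) + 1 := by omega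
    rw [h]
    exact f.mul_mem hx hy

theorem mul_low_mem {i j : ℕ} {x y : D} (hx : x ∈ f.F i) (hy : y ∈ f.low j) :
    x * y ∈ f.low (i + j) := by
  cases j with
  | zero =>
    have h : y = 0 := hy
    rw [h, mul_zero]
    exact Submodule.zero_mem _
  | succ j => exact f.mul_mem hx hy

/-- The degree `n` component `F n / F (n - 1)` of the associated graded algebra. -/
abbrev Gr (n : ℕ) : Type _ := f.F n ⧸ (f.low n).submoduleOf (f.F n)

/-- The class in `F n / F (n - 1)` of an element of `F n`. -/
def cls (n : ℕ) : f.F n →ₗ[K] f.Gr n := Submodule.mkQ _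

theorem cls_surjective (n : ℕ) (z : f.Gr n) : ∃ x : D, ∃ hx : x ∈ f.F n, f.cls n ⟨x, hx⟩ = z := by
  obtain ⟨⟨x, hx⟩, h⟩ := Submodule.mkQ_surjective _ z
  exact ⟨x, hx, h⟩

theorem cls_eq_zero {n : ℕ} {x : f.F n} (h : (x : D) ∈ f.low n) : f.cls n x = 0 := by
  rw [cls, Submodule.mkQ_apply, Submodule.Quotient.mk_eq_zero]
  exact h

/-- Multiplication `F i × F j → F (i + j) / F (i + j - 1)`. -/
def preMul (i j : ℕ) : f.F i →ₗ[K] f.F j →ₗ[K] f.Gr (i + j) :=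
  LinearMap.mk₂ K (fun x y => f.cls (i + j) ⟨(x : D) * (y : D), f.mul_mem x.2 y.2⟩)
    (fun x x' y => by rw [← map_add]; congr 1; ext; simp [add_mul])
    (fun c x y => by rw [← map_smul]; congr 1; ext; simp)
    (fun x y y' => by rw [← map_add]; congr 1; ext; simp [mul_add])
    (fun c x y => by rw [← map_smul]; congr 1; ext; simp)

/-- The multiplication `Gr i × Gr j → Gr (i + j)` induced by that of `D`. -/
def grMul (i j : ℕ) : f.Gr i →ₗ[K] f.Gr j →ₗ[K] f.Gr (i + j) :=
  Submodule.liftQ _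
    (LinearMap.flip (Submodule.liftQ _ (LinearMap.flip (f.preMul i j)) (by
      intro y hy
      rw [LinearMap.mem_ker]
      ext x
      exact f.cls_eq_zero (f.mul_low_mem x.2 hy))))
    (by
      intro x hx
      rw [LinearMap.mem_ker]
      ext y
      exact f.cls_eq_zero (f.low_mul_mem hx y.2))

theorem grMul_cls {i j : ℕ} {x y : D} (hx : x ∈ f.F i) (hy : y ∈ f.F j) :
    f.grMul i j (f.cls i ⟨x, hx⟩) (f.cls j ⟨y, hy⟩)
      = f.cls (i + j) ⟨x * y, f.mul_mem hx hy⟩ := rfl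

theorem mk_cls_eq {m n : ℕ} {x y : D} (hx : x ∈ f.F m) (hy : y ∈ f.F n) (hmn : m = n)
    (hxy : x = y) :
    GradedMonoid.mk (A := f.Gr) m (f.cls m ⟨x, hx⟩) = GradedMonoid.mk n (f.cls n ⟨y, hy⟩) := by
  subst hmn
  subst hxy
  rfl

instance : GradedMonoid.GOne f.Gr where
  one := f.cls 0 ⟨1, f.one_mem⟩

instance : GradedMonoid.GMul f.Gr where
  mul {i j} a b := f.grMul i j a b

instance : DirectSum.GSemiring f.Gr where
  mul_zero a := map_zero _
  zero_mul {i j} b := LinearMap.map_zero₂ (f.grMul i j) b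
  mul_add a b c := map_add _ _ _
  add_mul {i j} a b c := LinearMap.map_add₂ (f.grMul i j) a b c
  one_mul := by
    rintro ⟨n, z⟩
    obtain ⟨x, hx, rfl⟩ := f.cls_surjective n z
    exact f.mk_cls_eq _ _ (zero_add n) (one_mul x)
  mul_one := by
    rintro ⟨n, z⟩
    obtain ⟨x, hx, rfl⟩ := f.cls_surjective n z
    exact f.mk_cls_eq _ _ (add_zero n) (mul_one x)
  mul_assoc := by
    rintro ⟨l, z⟩ ⟨m, v⟩ ⟨n, w⟩
    obtain ⟨x, hx, rfl⟩ := f.cls_surjective l z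
    obtain ⟨y, hy, rfl⟩ := f.cls_surjective m v
    obtain ⟨t, ht, rfl⟩ := f.cls_surjective n w
    exact f.mk_cls_eq _ _ (add_assoc l m n) (mul_assoc x y t)
  natCast n := n • f.cls 0 ⟨1, f.one_mem⟩
  natCast_zero := zero_smul _ _
  natCast_succ n := succ_nsmul _ n

theorem algebraMap_mem (r : K) : algebraMap K D r ∈ f.F 0 := by
  rw [Algebra.algebraMap_eq_smul_one]
  exact Submodule.smul_mem _ _ f.one_mem

instance : DirectSum.GAlgebra K f.Gr where
  toFun := AddMonoidHom.mk' (fun r => f.cls 0 ⟨algebraMap K D r, f.algebraMap_mem r⟩)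
    (fun r s => by rw [← map_add]; congr 1; ext; simp)
  map_one := by
    change f.cls 0 _ = f.cls 0 _
    congr 1
    ext
    simp
  map_mul r s := f.mk_cls_eq _ (f.mul_mem (f.algebraMap_mem r) (f.algebraMap_mem s)) rfl
    (map_mul _ r s)
  commutes r := by
    rintro ⟨n, z⟩
    obtain ⟨x, hx, rfl⟩ := f.cls_surjective n z
    exact f.mk_cls_eq (f.mul_mem (f.algebraMap_mem r) hx) (f.mul_mem hx (f.algebraMap_mem r))
      (add_comm 0 n) (Algebra.commutes r x)
  smul_def r := by
    rintro ⟨n, z⟩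
    obtain ⟨x, hx, rfl⟩ := f.cls_surjective n z
    exact f.mk_cls_eq (Submodule.smul_mem _ r hx) (f.mul_mem (f.algebraMap_mem r) hx)
      (zero_add n).symm (Algebra.smul_def r x)

/-- The associated graded algebra `gr D = ⨁ n, F n / F (n - 1)`. -/
abbrev gr : Type _ := ⨁ n, f.Gr n

/-- The homogeneous element of degree `n` of `gr D` defined by an element of `F n`. -/
noncomputable def symb (n : ℕ) : f.F n →ₗ[K] f.gr := DirectSum.lof K ℕ f.Gr n ∘ₗ f.cls n

end AlgFiltration

/-! ### PBW deformations in the category of `G`-modules -/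

/-- `A` with the subspaces `𝒜 n` is an `ℕ`-graded algebra in the category of `K G`-modules,
where `G` acts on `A` by algebra automorphisms through `ρ`. -/
structure IsGradedGAlgebra {K A G : Type*} [Field K] [Ring A] [Algebra K A] [Group G]
    (ρ : G →* (A ≃ₐ[K] A)) (𝒜 : ℕ → Submodule K A) : Prop where
  gradedMonoid : SetLike.GradedMonoid 𝒜
  isInternal : DirectSum.IsInternal 𝒜
  stable : ∀ (g : G) (n : ℕ), ∀ x ∈ 𝒜 n, ρ g x ∈ 𝒜 n

/-- The filtered algebra `(D, f)` is a PBW deformation of the graded algebra `(A, 𝒜)` in the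
category of `K G`-modules: `A` is a graded algebra and `D` a filtered algebra in that category,
and there is a `G`-equivariant isomorphism of graded algebras `gr D ≅ A`. -/
structure IsPBWDeformation {K A D G : Type*} [Field K] [Ring A] [Algebra K A] [Ring D]
    [Algebra K D] [Group G] (ρA : G →* (A ≃ₐ[K] A)) (𝒜 : ℕ → Submodule K A)
    (ρD : G →* (D ≃ₐ[K] D)) (f : AlgFiltration K D) : Prop where
  graded : IsGradedGAlgebra ρA 𝒜
  filtered : ∀ (g : G) (n : ℕ), ∀ x ∈ f.F n, ρD g x ∈ f.F n
  exists_equiv : ∃ e : f.gr ≃ₐ[K] A,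
    (∀ n : ℕ, (LinearMap.range (f.symb n)).map e.toLinearMap = 𝒜 n) ∧
    ∀ (g : G) (n : ℕ) (x : D) (hx : x ∈ f.F n),
      e (f.symb n ⟨ρD g x, filtered g n x hx⟩) = ρA g (e (f.symb n ⟨x, hx⟩))

/-! ### Word degree in an algebra with given generators -/

section Words

variable {K A X : Type*} [Field K] [Ring A] [Algebra K A]

/-- The span of the words of length exactly `n` in the elements `s x`, `x : X`. -/
def wordsEq (K : Type*) {A X : Type*} [Field K] [Ring A] [Algebra K A] (s : X → A) (n : ℕ) :
    Submodule K A :=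
  Submodule.span K {z | ∃ l : List X, l.length = n ∧ (l.map s).prod = z}

/-- The span of the words of length at most `n` in the elements `s x`, `x : X`. -/
def wordsLE (K : Type*) {A X : Type*} [Field K] [Ring A] [Algebra K A] (s : X → A) (n : ℕ) :
    Submodule K A :=
  Submodule.span K {z | ∃ l : List X, l.length ≤ n ∧ (l.map s).prod = z}

theorem wordsLE_mono (s : X → A) : Monotone (wordsLE K s) := by
  intro m n hmn
  apply Submodule.span_mono
  rintro z ⟨l, hl, rfl⟩
  exact ⟨l, hl.trans hmn, rfl⟩

theorem wordsLE_mul_mem (s : X → A) {i j : ℕ} {x y : A} (hx : x ∈ wordsLE K s i)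
    (hy : y ∈ wordsLE K s j) : x * y ∈ wordsLE K s (i + j) := by
  have h := Submodule.mul_mem_mul hx hy
  rw [wordsLE, wordsLE, Submodule.span_mul_span] at h
  refine Submodule.span_mono ?_ h
  rintro z ⟨_, ⟨l, hl, rfl⟩, _, ⟨l', hl', rfl⟩, rfl⟩
  refine ⟨l ++ l', ?_, by simp⟩
  rw [List.length_append]
  omega

theorem exists_mem_wordsLE (s : X → A) (hs : Algebra.adjoin K (Set.range s) = ⊤) (x : A) :
    ∃ n, x ∈ wordsLE K s n := by
  have hx : x ∈ Algebra.adjoin K (Set.range s) := by rw [hs]; trivial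
  have one_mem : ∀ n, (1 : A) ∈ wordsLE K s n := fun n =>
    Submodule.subset_span ⟨[], Nat.zero_le _, rfl⟩
  induction hx using Algebra.adjoin_induction with
  | mem z hz =>
    obtain ⟨i, rfl⟩ := hz
    exact ⟨1, Submodule.subset_span ⟨[i], le_rfl, by simp⟩⟩
  | algebraMap r =>
    refine ⟨0, ?_⟩
    rw [Algebra.algebraMap_eq_smul_one]
    exact Submodule.smul_mem _ _ (one_mem 0)
  | add y z _ _ h1 h2 =>
    obtain ⟨m, hm⟩ := h1
    obtain ⟨n, hn⟩ := h2
    exact ⟨m + n, Submodule.add_mem _ (wordsLE_mono s (Nat.le_add_right m n) hm)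
      (wordsLE_mono s (Nat.le_add_left n m) hn)⟩
  | mul y z _ _ h1 h2 =>
    obtain ⟨m, hm⟩ := h1
    obtain ⟨n, hn⟩ := h2
    exact ⟨m + n, wordsLE_mul_mem s hm hn⟩

/-- The filtration of an algebra by word length in a family of generators. -/
def wordFiltration (s : X → A) (hs : Algebra.adjoin K (Set.range s) = ⊤) : AlgFiltration K A where
  F := wordsLE K s
  mono := wordsLE_mono s
  one_mem := Submodule.subset_span ⟨[], Nat.zero_le _, rfl⟩
  mul_mem := wordsLE_mul_mem s
  exhaustive := exists_mem_wordsLE s hs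

theorem adjoin_ringQuot (r : FreeAlgebra K X → FreeAlgebra K X → Prop) :
    Algebra.adjoin K (Set.range fun x : X => RingQuot.mkAlgHom K r (FreeAlgebra.ι K x)) = ⊤ := by
  have h : (Set.range fun x : X => RingQuot.mkAlgHom K r (FreeAlgebra.ι K x))
      = RingQuot.mkAlgHom K r '' Set.range (FreeAlgebra.ι K) := by
    rw [← Set.range_comp]
    rfl
  rw [h, ← AlgHom.map_adjoin, FreeAlgebra.adjoin_range_ι, Algebra.map_top, AlgHom.range_eq_top]
  exact RingQuot.mkAlgHom_surjective K r

end Words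

/-! ### The tetrahedron: generators, group, and the algebras `B` and `T(α₁, α₂, α₃)` -/

namespace Tetra

/-- The four generators. -/
inductive Gen : Type
  | a | b | c | d

/-- The defining relations `u = v` of the group `G`, with `g_x` for `x : Gen`:
`g_a g_b = g_b g_c = g_c g_a`, `g_a g_c = g_c g_d = g_d g_a`, `g_a g_d = g_d g_b = g_b g_a`,
`g_b g_d = g_d g_c = g_c g_b`. -/
inductive GroupRel : FreeGroup Gen → FreeGroup Gen → Prop
  | ab_bc : GroupRel (.of .a * .of .b) (.of .b * .of .c)
  | bc_ca : GroupRel (.of .b * .of .c) (.of .c * .of .a)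
  | ac_cd : GroupRel (.of .a * .of .c) (.of .c * .of .d)
  | cd_da : GroupRel (.of .c * .of .d) (.of .d * .of .a)
  | ad_db : GroupRel (.of .a * .of .d) (.of .d * .of .b)
  | db_ba : GroupRel (.of .d * .of .b) (.of .b * .of .a)
  | bd_dc : GroupRel (.of .b * .of .d) (.of .d * .of .c)
  | dc_cb : GroupRel (.of .d * .of .c) (.of .c * .of .b)

/-- The group `G` (the enveloping group of the tetrahedron rack). -/
abbrev G : Type := PresentedGroup {w : FreeGroup Gen | ∃ u v, GroupRel u v ∧ w = u * v⁻¹}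

/-- The generator `g_x` of `G`. -/
def g (x : Gen) : G := PresentedGroup.of x

/-- The rack operation: `g_x` acts on the generator `z` of the algebras as `-(op x z)`. -/
def op : Gen → Gen → Gen
  | .a, .a => .a | .a, .b => .c | .a, .c => .d | .a, .d => .b
  | .b, .a => .d | .b, .b => .b | .b, .c => .a | .b, .d => .c
  | .c, .a => .b | .c, .b => .d | .c, .c => .c | .c, .d => .a
  | .d, .a => .c | .d, .b => .a | .d, .c => .b | .d, .d => .d

variable (K : Type*) [Field K]

/-- The free generator `a`; similarly for `b`, `c`, `d` below. -/
abbrev fa : FreeAlgebra K Gen := FreeAlgebra.ι K .a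
abbrev fb : FreeAlgebra K Gen := FreeAlgebra.ι K .b
abbrev fc : FreeAlgebra K Gen := FreeAlgebra.ι K .c
abbrev fd : FreeAlgebra K Gen := FreeAlgebra.ι K .d

/-- The defining relations of `B`. -/
inductive BRel : FreeAlgebra K Gen → FreeAlgebra K Gen → Prop
  | aa : BRel (fa K ^ 2) 0
  | bb : BRel (fb K ^ 2) 0
  | cc : BRel (fc K ^ 2) 0
  | dd : BRel (fd K ^ 2) 0
  | abc : BRel (fa K * fb K + fb K * fc K + fc K * fa K) 0
  | acd : BRel (fa K * fc K + fc K * fd K + fd K * fa K) 0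
  | adb : BRel (fa K * fd K + fb K * fa K + fd K * fb K) 0
  | bdc : BRel (fb K * fd K + fc K * fb K + fd K * fc K) 0
  | six : BRel ((fa K + fb K + fc K) ^ 6) 0

/-- The algebra `B`. -/
abbrev B : Type _ := RingQuot (BRel K)

/-- The generators of `B`. -/
noncomputable def bgen (x : Gen) : B K := RingQuot.mkAlgHom K (BRel K) (FreeAlgebra.ι K x)

/-- The homogeneous components of `B`, with all generators in degree one. -/
noncomputable def bdeg (n : ℕ) : Submodule K (B K) := wordsEq K (bgen K) n

variable {K}

/-- The defining relations of `T(α₁, α₂, α₃)`. -/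
inductive TRel (α₁ α₂ α₃ : K) : FreeAlgebra K Gen → FreeAlgebra K Gen → Prop
  | aa : TRel α₁ α₂ α₃ (fa K ^ 2 - algebraMap K _ α₁) 0
  | bb : TRel α₁ α₂ α₃ (fb K ^ 2 - algebraMap K _ α₁) 0
  | cc : TRel α₁ α₂ α₃ (fc K ^ 2 - algebraMap K _ α₁) 0
  | dd : TRel α₁ α₂ α₃ (fd K ^ 2 - algebraMap K _ α₁) 0
  | cab : TRel α₁ α₂ α₃ (fc K * fa K + fb K * fc K + fa K * fb K - algebraMap K _ α₂) 0
  | dac : TRel α₁ α₂ α₃ (fd K * fa K + fc K * fd K + fa K * fc K - algebraMap K _ α₂) 0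
  | dba : TRel α₁ α₂ α₃ (fd K * fb K + fb K * fa K + fa K * fd K - algebraMap K _ α₂) 0
  | dcb : TRel α₁ α₂ α₃ (fd K * fc K + fc K * fb K + fb K * fd K - algebraMap K _ α₂) 0
  | six : TRel α₁ α₂ α₃
      ((fc K * fb K + fb K * fa K + fa K * fc K - algebraMap K _ α₂) ^ 3 - algebraMap K _ α₃) 0

/-- The algebra `T(α₁, α₂, α₃)`. -/
abbrev T (α₁ α₂ α₃ : K) : Type _ := RingQuot (TRel α₁ α₂ α₃)

/-- The generators of `T(α₁, α₂, α₃)`. -/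
noncomputable def tgen (α₁ α₂ α₃ : K) (x : Gen) : T α₁ α₂ α₃ :=
  RingQuot.mkAlgHom K (TRel α₁ α₂ α₃) (FreeAlgebra.ι K x)

/-- The element `y = ac + cb + ba - α₂` of `T(α₁, α₂, α₃)`. -/
noncomputable def y (α₁ α₂ α₃ : K) : T α₁ α₂ α₃ :=
  tgen α₁ α₂ α₃ .a * tgen α₁ α₂ α₃ .c + tgen α₁ α₂ α₃ .c * tgen α₁ α₂ α₃ .b
    + tgen α₁ α₂ α₃ .b * tgen α₁ α₂ α₃ .a - algebraMap K _ α₂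

/-- The filtration of `T(α₁, α₂, α₃)` by word length in `a, b, c, d`. -/
noncomputable def tfilt (α₁ α₂ α₃ : K) : AlgFiltration K (T α₁ α₂ α₃) :=
  wordFiltration (tgen α₁ α₂ α₃) (adjoin_ringQuot (TRel α₁ α₂ α₃))

end Tetra

/-!
The proof builds `T(α₁, α₂, α₃)` as a tower of free left modules of finite rank. With `w = b - a`,
the relations give `w³ = (3α₁ - α₂) w`, and they allow every word to be rewritten so that `a` stands
to the right of `w`, then `c` and `y`, then `d`. The rules needed are `a w = -w a - w²`, the
relations for `ca` and `da`, `db`, `dc`, and `y a = c y`, `y b = a y`, `y c = b y`: the element `y`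
is normal, it permutes `a`, `b`, `c` cyclically, and it commutes with `d`. Hence the 72 monomials
span (`QuadRel.adjoin_le_span`, which climbs the tower with `adjoin_le_span_mul`).

They are independent because the tower exists. In a free left module with basis `e₁, …, eₙ` over
an algebra `R`, right multiplication is given by `n × n` matrices over `R` acting on row vectors.
Writing down these matrices for the four stages `1, w, w²`, then `1, a`, then `cⁱ yʲ`, then `1, d`,
yields nested matrix algebras whose elements satisfy the defining relations (`exists_quad`);
the first row of the matrix of a monomial shows its coordinates, so the monomials are independent
there (`ScalesBy.linearIndependent`), and therefore also in `T(α₁, α₂, α₃)`.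

As `(a + b + c)² = y + 3α₁ + 2α₂`, the algebra `B` is given by the relations of `T(0, 0, 0)`, so the
same monomials form a basis of it. They are homogeneous, which gives the Hilbert series. The
defining relations of `T` are stable under `G` because the cube of `dc + ca + ad - α₂` equals `y³`
already modulo the quadratic relations (`QuadRel.cube_eq`).

Finally the relations of `B` hold in `gr T` (`IsTetra.exists_isGrHom`). The resulting homomorphism
`B → gr T` is onto in every degree, and therefore the part of `T` of filtration degree `n`
is spanned by the monomials of degree at most `n`. Independence of the monomials in `T` then makes the
homomorphism injective (`IsTetra.IsGrHom.injective`). It is equivariant because every element of `G`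
permutes the generators of `B` and `T` in the same way, up to a common scalar.
-/

/-! ### Consequences of the quadratic relations -/

namespace Tetra

/-- The quadratic relations of `T(α₁, α₂, α₃)` that involve only `a`, `b` and `c`. -/
structure TriRel {K D : Type*} [Field K] [Ring D] [Algebra K D] (α₁ α₂ : K) (a b c : D) :
    Prop where
  aa : a * a = α₁ • 1
  bb : b * b = α₁ • 1
  cc : c * c = α₁ • 1
  ca : c * a = α₂ • 1 - b * c - a * b

/-- The quadratic relations of `T(α₁, α₂, α₃)`, those with three terms on the left solved for
`ca`, `da`, `db` and `dc`. -/
structure QuadRel {K D : Type*} [Field K] [Ring D] [Algebra K D] (α₁ α₂ : K) (a b c d : D) : Prop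
    extends TriRel α₁ α₂ a b c where
  dd : d * d = α₁ • 1
  da : d * a = α₂ • 1 - c * d - a * c
  db : d * b = α₂ • 1 - b * a - a * d
  dc : d * c = α₂ • 1 - c * b - b * d

/-- A rewriting rule for `x * y`, in the form that applies inside right-associated words. -/
theorem mul_mul_of_mul_eq {D : Type*} [Semigroup D] {x y r : D} (h : x * y = r) (t : D) :
    x * (y * t) = r * t := by rw [← mul_assoc, h]

namespace TriRel
variable {K D : Type*} [Field K] [Ring D] [Algebra K D] {α₁ α₂ : K} {a b c : D}

/-- Comparison of the two reductions of `(ca)a = c(aa)`. -/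
theorem braid (h : TriRel α₁ α₂ a b c) : b * (a * b) = a * (b * a) - α₂ • a + α₂ • b := by
  have h1 : (c * a) * a = α₁ • c := by rw [mul_assoc, h.aa]; simp
  rw [h.ca] at h1
  simp only [mul_sub, sub_mul, mul_assoc, h.ca, mul_mul_of_mul_eq h.bb, mul_smul_comm,
    smul_mul_assoc, mul_one, one_mul] at h1
  rw [← sub_eq_zero] at h1 ⊢
  rw [← h1]
  abel

theorem c_mul_b {y : D} (hy : y = a * c + c * b + b * a - α₂ • 1) :
    c * b = y + α₂ • 1 - a * c - b * a := by
  rw [hy]; abel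

theorem y_mul_a (h : TriRel α₁ α₂ a b c) {y : D} (hy : y = a * c + c * b + b * a - α₂ • 1) :
    y * a = c * y := by
  -- the word `cac` is reduced at `ca`; what remains of it cancels in the goal
  have h1 : c * (a * c) = c * (a * c) := rfl
  nth_rw 1 [mul_mul_of_mul_eq h.ca] at h1
  subst hy
  simp only [add_mul, mul_add, mul_sub, sub_mul, mul_assoc, mul_mul_of_mul_eq h.cc, h.cc, h.aa,
    h.ca, mul_smul_comm, smul_mul_assoc, mul_one, one_mul, mul_mul_of_mul_eq h.aa,
    mul_mul_of_mul_eq h.ca] at h1 ⊢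
  abel

theorem y_mul_b (h : TriRel α₁ α₂ a b c) {y : D} (hy : y = a * c + c * b + b * a - α₂ • 1) :
    y * b = a * y := by
  subst hy
  simp only [add_mul, mul_add, mul_sub, sub_mul, mul_assoc,
    mul_smul_comm, smul_mul_assoc, mul_one, one_mul, h.braid, h.bb, mul_mul_of_mul_eq h.aa]
  abel

theorem y_mul_c (h : TriRel α₁ α₂ a b c) {y : D} (hy : y = a * c + c * b + b * a - α₂ • 1) :
    y * c = b * y := by
  have h1 : c * (b * c) = α₂ • c - α₁ • a - c * (a * b) := by
    have : b * c = α₂ • 1 - c * a - a * b := by rw [h.ca]; abel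
    rw [this]
    simp only [mul_sub, mul_mul_of_mul_eq h.cc, mul_smul_comm, smul_mul_assoc, mul_one, one_mul]
  subst hy
  simp only [add_mul, mul_add, mul_sub, sub_mul, mul_assoc, h.cc, h1,
    mul_smul_comm, smul_mul_assoc, mul_one, one_mul, h.bb, mul_mul_of_mul_eq h.ca,
    mul_mul_of_mul_eq h.bb]
  abel

/-- The link between the relation of degree six of `B` and the cubic relation in `y`. -/
theorem sum_sq (h : TriRel α₁ α₂ a b c) :
    (a + b + c) ^ 2 = (a * c + c * b + b * a - α₂ • 1) + (3 * α₁ + 2 * α₂) • 1 := by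
  simp only [pow_two, add_mul, mul_add, h.aa, h.bb, h.cc, h.ca]
  module

theorem sub_mul_self (h : TriRel α₁ α₂ a b c) :
    (b - a) * ((b - a) * (b - a)) = (3 * α₁ - α₂) • (b - a) := by
  simp only [mul_sub, sub_mul, h.aa, h.bb, h.braid, mul_mul_of_mul_eq h.aa,
    mul_mul_of_mul_eq h.bb, smul_mul_assoc, mul_smul_comm, mul_one, one_mul]
  module

theorem mul_sub_self (h : TriRel α₁ α₂ a b c) :
    a * (b - a) = -((b - a) * a) - (b - a) * (b - a) := by
  simp only [mul_sub, sub_mul, h.aa, h.bb]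
  abel

end TriRel

namespace QuadRel
variable {K D : Type*} [Field K] [Ring D] [Algebra K D] {α₁ α₂ : K} {a b c d : D}

theorem d_mul_y (h : QuadRel α₁ α₂ a b c d) {y : D} (hy : y = a * c + c * b + b * a - α₂ • 1) :
    d * y = y * d := by
  subst hy
  simp only [add_mul, mul_add, mul_sub, sub_mul, mul_assoc, mul_mul_of_mul_eq h.cc, h.cc, h.aa,
    mul_smul_comm, smul_mul_assoc, mul_one, one_mul, h.bb, mul_mul_of_mul_eq h.aa,
    mul_mul_of_mul_eq h.bb, h.da, h.db, h.dc, mul_mul_of_mul_eq h.da,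
    mul_mul_of_mul_eq h.db, mul_mul_of_mul_eq h.dc]
  abel

/-- The elements `ac + cb + ba - α₂` and `ad + dc + ca - α₂`, attached to the triples `a, b, c` and
`a, c, d`, have the same cube. -/
theorem cube_eq (h : QuadRel α₁ α₂ a b c d) {y : D} (hy : y = a * c + c * b + b * a - α₂ • 1) :
    (d * c + c * a + a * d - α₂ • 1) ^ 3 = y ^ 3 := by
  have e : d * c + c * a + a * d - α₂ • 1 = (a - b) * d + c * (a - b) := by
    rw [h.dc, mul_sub, sub_mul]; abel
  have hca := h.ca
  have hcb := TriRel.c_mul_b hy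
  have hbab (t : D) : b * (a * (b * t)) = a * (b * (a * t)) - α₂ • (a * t) + α₂ • (b * t) := by
    have := congrArg (· * t) h.braid
    simpa only [sub_mul, add_mul, mul_assoc, smul_mul_assoc] using this
  -- the letters on both sides are now brought into the order of the PBW monomials
  have e2 : ((a - b) * d + c * (a - b)) * ((a - b) * d + c * (a - b))
      = (b - c) * (y * d) + a * (b * y) - a * (c * y) := by
    simp only [add_mul, mul_add, mul_sub, sub_mul, mul_assoc, h.cc, h.aa, h.ca, mul_smul_comm,
    smul_mul_assoc, mul_one, one_mul, h.braid, hbab, h.bb, h.dd, h.da, h.db, h.dc, hcb,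
    h.y_mul_a hy, h.y_mul_b hy,
    h.y_mul_c hy, h.d_mul_y hy, mul_mul_of_mul_eq h.ca,
    mul_mul_of_mul_eq h.aa, mul_mul_of_mul_eq h.bb, mul_mul_of_mul_eq h.da,
    mul_mul_of_mul_eq h.db, mul_mul_of_mul_eq hcb,
    mul_mul_of_mul_eq (h.y_mul_a hy), mul_mul_of_mul_eq (h.y_mul_b hy)]
    abel
  rw [e, pow_succ', pow_two, e2, pow_succ, pow_two]
  simp only [add_mul, mul_add, mul_sub, sub_mul, mul_assoc, h.ca, mul_smul_comm,
    smul_mul_assoc, mul_one, one_mul, hbab, h.dd, hcb,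
    h.d_mul_y hy, mul_mul_of_mul_eq h.cc, mul_mul_of_mul_eq h.ca,
    mul_mul_of_mul_eq h.aa, mul_mul_of_mul_eq h.bb, mul_mul_of_mul_eq h.da,
    mul_mul_of_mul_eq h.db, mul_mul_of_mul_eq h.dc, mul_mul_of_mul_eq hcb,
    mul_mul_of_mul_eq (h.y_mul_a hy), mul_mul_of_mul_eq (h.y_mul_b hy),
    mul_mul_of_mul_eq (h.y_mul_c hy),
    mul_mul_of_mul_eq (h.d_mul_y hy)]
  module

end QuadRel
end Tetra

/-! ### Matrix models with independent monomials -/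

namespace Tetra
universe u

/-- Left multiplication by `X` scales the coordinates `ρ` by `x` on the left. For `S` an algebra of
matrices over `R` and `ρ` its first row, this says that the first row of `X` is `(x, 0, …, 0)`. -/
def ScalesBy {K R S n : Type*} [Field K] [Ring R] [Algebra K R] [Ring S] [Algebra K S]
    (ρ : S →ₗ[K] n → R) (X : S) (x : R) : Prop :=
  ∀ Z l, ρ (X * Z) l = x * ρ Z l

namespace ScalesBy
variable {K R S n : Type*} [Field K] [Ring R] [Algebra K R] [Ring S] [Algebra K S]
  {ρ : S →ₗ[K] n → R} {X Y : S} {x y : R}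

theorem mul (hX : ScalesBy ρ X x) (hY : ScalesBy ρ Y y) : ScalesBy ρ (X * Y) (x * y) := by
  intro Z l
  rw [mul_assoc, hX, hY, mul_assoc]

theorem sub (hX : ScalesBy ρ X x) (hY : ScalesBy ρ Y y) : ScalesBy ρ (X - Y) (x - y) := by
  intro Z l
  rw [sub_mul, map_sub, Pi.sub_apply, hX, hY, sub_mul]

theorem add (hX : ScalesBy ρ X x) (hY : ScalesBy ρ Y y) : ScalesBy ρ (X + Y) (x + y) := by
  intro Z l
  rw [add_mul, map_add, Pi.add_apply, hX, hY, add_mul]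

theorem smul_one (r : K) : ScalesBy ρ (r • 1) (r • 1) := by
  intro Z l
  simp

theorem pow (hX : ScalesBy ρ X x) (m : ℕ) : ScalesBy ρ (X ^ m) (x ^ m) := by
  induction m with
  | zero => intro Z l; simp
  | succ m ih => rw [pow_succ, pow_succ]; exact ih.mul hX

/-- If the `F i` scale the coordinates by independent elements `f i`, and the `G k` have distinct
unit vectors as coordinates, then the products `F i * G k` are independent. -/
theorem linearIndependent {ι κ : Type*} [Fintype ι] [Fintype κ] [DecidableEq κ] {f : ι → R}
    {F : ι → S} {G : κ → S} (e : κ → n) (hf : LinearIndependent K f)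
    (hF : ∀ i, ScalesBy ρ (F i) (f i))
    (hG : ∀ k k', ρ (G k) (e k') = if k = k' then 1 else 0) :
    LinearIndependent K fun p : ι × κ => F p.1 * G p.2 := by
  rw [Fintype.linearIndependent_iff] at hf ⊢
  rintro t ht ⟨i, k⟩
  refine hf (fun i => t (i, k)) ?_ i
  have h := congrFun (congrArg ρ ht) (e k)
  rw [map_sum, Finset.sum_apply, Fintype.sum_prod_type, map_zero] at h
  simpa [hF _ _ _, hG] using h

end ScalesBy

/-- The `i`-th row of a matrix. -/
def rowMap (K : Type*) {R n : Type*} [Field K] [Ring R] [Algebra K R] (i : n) :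
    Matrix n n R →ₗ[K] n → R where
  toFun X := X i
  map_add' _ _ := rfl
  map_smul' _ _ := rfl

@[simp]
theorem rowMap_apply {K R n : Type*} [Field K] [Ring R] [Algebra K R] (i : n)
    (X : Matrix n n R) (j : n) : rowMap K i X j = X i j := rfl

/-- The row with index `(i, j)` of a matrix of matrices. -/
def blockRowMap (K : Type*) {R m n : Type*} [Field K] [Ring R] [Algebra K R] (i : m) (j : n) :
    Matrix m m (Matrix n n R) →ₗ[K] m × n → R where
  toFun X p := X i p.1 j p.2
  map_add' _ _ := rfl
  map_smul' _ _ := rfl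

@[simp]
theorem blockRowMap_apply {K R m n : Type*} [Field K] [Ring R] [Algebra K R] (i : m) (j : n)
    (X : Matrix m m (Matrix n n R)) (p : m × n) : blockRowMap K i j X p = X i p.1 j p.2 := rfl

/-- The powers of the companion matrix of `t³ - r t`. -/
theorem exists_cubic {K : Type u} [Field K] (r : K) :
    ∃ (R : Type u) (_ : Ring R) (_ : Algebra K R) (w : R), w * (w * w) = r • w ∧
      LinearIndependent K fun i : Fin 3 => w ^ (i : ℕ) := by
  let w : Matrix (Fin 3) (Fin 3) K := !![0, 1, 0; 0, 0, 1; 0, r, 0]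
  refine ⟨Matrix (Fin 3) (Fin 3) K, inferInstance, inferInstance, w, ?_, ?_⟩
  · ext i j
    fin_cases i <;> fin_cases j <;> simp [w, Matrix.mul_apply, Fin.sum_univ_three]
  · rw [Fintype.linearIndependent_iff]
    intro t ht i
    have h := congrFun (congrFun ht 0) i
    fin_cases i <;> simpa [w, Fin.sum_univ_three, pow_two, Matrix.mul_apply,
      Matrix.one_apply] using h

/-- A model of the subalgebra generated by `a` and `b`, with `b = w + a`: its elements are
`2 × 2` matrices over the algebra generated by `w`, with respect to the basis `1, a`. -/
theorem exists_braid {K : Type u} [Field K] (α₁ α₂ : K) :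
    ∃ (R : Type u) (_ : Ring R) (_ : Algebra K R) (a b : R), a * a = α₁ • 1 ∧ b * b = α₁ • 1 ∧
      b * (a * b) = a * (b * a) - α₂ • a + α₂ • b ∧
      LinearIndependent K fun p : Fin 3 × Fin 2 => (b - a) ^ (p.1 : ℕ) * a ^ (p.2 : ℕ) := by
  obtain ⟨R, _, _, w, hw, hli⟩ := exists_cubic (3 * α₁ - α₂)
  let W : Matrix (Fin 2) (Fin 2) R := !![w, 0; -(w * w), -w]
  let A : Matrix (Fin 2) (Fin 2) R := !![0, 1; α₁ • 1, 0]
  have hA : A * A = α₁ • 1 := by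
    ext i j
    fin_cases i <;> fin_cases j <;> simp [A, Matrix.mul_apply]
  have hAW : A * W = - (W * A) - W * W := by
    ext i j
    fin_cases i <;> fin_cases j <;> simp [A, W, Matrix.mul_apply, mul_assoc]
  have hW : W * (W * W) = (3 * α₁ - α₂) • W := by
    ext i j
    fin_cases i <;> fin_cases j <;> simp [W, Matrix.mul_apply, mul_assoc, hw]
  refine ⟨Matrix (Fin 2) (Fin 2) R, inferInstance, inferInstance, A, A + W, hA, ?_, ?_, ?_⟩
  · simp only [mul_add, add_mul, hA, hAW]
    abel
  · simp only [mul_add, add_mul, mul_sub, sub_mul, mul_assoc, mul_neg, neg_mul, hA, hAW,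
      mul_mul_of_mul_eq hAW, mul_smul_comm, mul_one, hW]
    module
  · simp only [add_sub_cancel_left]
    refine ScalesBy.linearIndependent (K := K) (ρ := rowMap K (0 : Fin 2))
      (f := fun i : Fin 3 => w ^ (i : ℕ)) (F := fun i : Fin 3 => W ^ (i : ℕ))
      (G := fun j : Fin 2 => A ^ (j : ℕ)) id hli
      (fun i => ScalesBy.pow ?_ i) ?_
    · intro Z l
      simp [W, Matrix.vecMul, dotProduct]
    · intro k l
      fin_cases k <;> fin_cases l <;> simp [A]

/-- The matrices of `a`, `b`, `c` and `y` with respect to the block basis `1, y, y²`. Here `P`, `C`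
and `Q + N y` stand for right multiplication by `a`, `c` and `b` in the first block. As `y` permutes
`a`, `b`, `c` cyclically, the same operators occur in the other two blocks in rotated order, and
`y³ = α₃` accounts for the entry `α₃ • N`. -/
theorem triRel_blocks {K S : Type*} [Field K] [Ring S] [Algebra K S] {α₁ α₂ : K} (α₃ : K)
    {P Q C N : S} (hPP : P * P = α₁ • 1) (hQQ : Q * Q = α₁ • 1) (hCC : C * C = α₁ • 1)
    (hNN : N * N = 0) (hQN : Q * N + N * P = 0) (hPN : P * N + N * Q = 0)
    (hCN : C * N + N * C = 1) (hPQ : P * Q + Q * C + C * P = α₂ • 1)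
    (hPC : P * C + C * Q + Q * P = α₂ • 1) :
    TriRel α₁ α₂ !![P, 0, 0; 0, C, 0; α₃ • N, 0, Q] !![Q, N, 0; 0, P, 0; 0, 0, C]
        !![C, 0, 0; 0, Q, N; 0, 0, P] ∧
      (!![P, 0, 0; 0, C, 0; α₃ • N, 0, Q] * !![C, 0, 0; 0, Q, N; 0, 0, P]
          + !![C, 0, 0; 0, Q, N; 0, 0, P] * !![Q, N, 0; 0, P, 0; 0, 0, C]
          + !![Q, N, 0; 0, P, 0; 0, 0, C] * !![P, 0, 0; 0, C, 0; α₃ • N, 0, Q] - α₂ • 1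
        : Matrix (Fin 3) (Fin 3) S) = !![0, 1, 0; 0, 0, 1; α₃ • 1, 0, 0] := by
  have hNP : N * P + Q * N = 0 := by rw [add_comm, hQN]
  have hNQ : N * Q + P * N = 0 := by rw [add_comm, hPN]
  have hNC : N * C + C * N = 1 := by rw [add_comm, hCN]
  have h3 : C * Q + Q * P + P * C = α₂ • 1 := by rw [← hPC]; abel
  have h4 : Q * P + P * C + C * Q = α₂ • 1 := by rw [← hPC]; abel
  have h5 : C * P + (Q * C + P * Q) = α₂ • 1 := by rw [← hPQ]; abel
  have h6 : Q * C + (P * Q + C * P) = α₂ • 1 := by rw [← hPQ]; abel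
  have h7 : P * Q + (C * P + Q * C) = α₂ • 1 := by rw [← hPQ]; abel
  refine ⟨⟨?_, ?_, ?_, ?_⟩, ?_⟩
  · simp [Matrix.one_fin_three, hPP, hQQ, hCC, ← smul_add, hNP]
  · simp [Matrix.one_fin_three, hPP, hQQ, hCC, hQN]
  · simp [Matrix.one_fin_three, hPP, hQQ, hCC, hQN]
  · rw [sub_sub, eq_sub_iff_add_eq]
    simp [Matrix.one_fin_three, hNN, hPN, hNQ, h5, h6, h7, ← smul_add]
  · rw [sub_eq_iff_eq_add]
    simp [Matrix.one_fin_three, ← smul_add, hPC, h3, h4, hCN, hNC]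

/-- A model of the subalgebra generated by `a`, `b` and `c`: matrices over the algebra generated by
`a` and `b`, with respect to the basis `cⁱ yʲ`. -/
theorem exists_tri {K : Type u} [Field K] (α₁ α₂ α₃ : K) :
    ∃ (R : Type u) (_ : Ring R) (_ : Algebra K R) (a b c : R), TriRel α₁ α₂ a b c ∧
      (a * c + c * b + b * a - α₂ • 1) ^ 3 = α₃ • 1 ∧
      LinearIndependent K fun p : (Fin 3 × Fin 2) × (Fin 2 × Fin 3) =>
        ((b - a) ^ (p.1.1 : ℕ) * a ^ (p.1.2 : ℕ)) *
          (c ^ (p.2.1 : ℕ) * (a * c + c * b + b * a - α₂ • 1) ^ (p.2.2 : ℕ)) := by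
  obtain ⟨R, _, _, a, b, ha, hb, hbab, hli⟩ := exists_braid α₁ α₂
  let P : Matrix (Fin 2) (Fin 2) R := !![a, 0; α₂ • 1 - a * b, -b]
  let Q : Matrix (Fin 2) (Fin 2) R := !![b, 0; α₂ • 1 - b * a, -a]
  let C : Matrix (Fin 2) (Fin 2) R := !![0, 1; α₁ • 1, 0]
  let N : Matrix (Fin 2) (Fin 2) R := !![0, 0; 1, 0]
  have hPP : P * P = α₁ • 1 := by
    ext i j
    fin_cases i <;> fin_cases j <;>
      simp [P, Matrix.mul_apply, mul_sub, sub_mul, ha, hb, mul_assoc, hbab]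
  have hQQ : Q * Q = α₁ • 1 := by
    ext i j
    fin_cases i <;> fin_cases j <;>
      simp [Q, Matrix.mul_apply, mul_sub, sub_mul, ha, hb, mul_assoc, hbab]
  have hCC : C * C = α₁ • 1 := by
    ext i j
    fin_cases i <;> fin_cases j <;> simp [C, Matrix.mul_apply]
  have hNN : N * N = 0 := by
    ext i j
    fin_cases i <;> fin_cases j <;> simp [N, Matrix.mul_apply]
  have hQN : Q * N + N * P = 0 := by
    ext i j
    fin_cases i <;> fin_cases j <;> simp [P, Q, N]
  have hPN : P * N + N * Q = 0 := by
    ext i j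
    fin_cases i <;> fin_cases j <;> simp [P, Q, N]
  have hCN : C * N + N * C = 1 := by
    ext i j
    fin_cases i <;> fin_cases j <;> simp [C, N]
  have hPQ : P * Q + Q * C + C * P = α₂ • 1 := by
    ext i j
    fin_cases i <;> fin_cases j <;>
      simp [P, Q, C, mul_sub, sub_mul, hb, mul_assoc, mul_mul_of_mul_eq hb]
  have hPC : P * C + C * Q + Q * P = α₂ • 1 := by
    ext i j
    fin_cases i <;> fin_cases j <;>
      simp [P, Q, C, mul_sub, sub_mul, ha, mul_assoc, mul_mul_of_mul_eq ha]
  obtain ⟨htri, hy⟩ := triRel_blocks α₃ hPP hQQ hCC hNN hQN hPN hCN hPQ hPC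
  refine ⟨Matrix (Fin 3) (Fin 3) (Matrix (Fin 2) (Fin 2) R), inferInstance, inferInstance,
    _, _, _, htri, ?_, ?_⟩
  · rw [hy]
    simp [pow_succ, Matrix.one_fin_three]
  · rw [hy]
    have hA : ScalesBy (blockRowMap K (0 : Fin 3) (0 : Fin 2))
        !![P, 0, 0; 0, C, 0; α₃ • N, 0, Q] a := by
      intro Z l
      simp [Matrix.vecMul, dotProduct, Fin.sum_univ_three, P]
    have hB : ScalesBy (blockRowMap K (0 : Fin 3) (0 : Fin 2))
        !![Q, N, 0; 0, P, 0; 0, 0, C] b := by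
      intro Z l
      simp [Matrix.vecMul, dotProduct, Fin.sum_univ_three, Q, N]
    refine ScalesBy.linearIndependent (K := K) (ρ := blockRowMap K (0 : Fin 3) (0 : Fin 2))
      (f := fun p : Fin 3 × Fin 2 => (b - a) ^ (p.1 : ℕ) * a ^ (p.2 : ℕ))
      (F := fun p : Fin 3 × Fin 2 => (!![Q, N, 0; 0, P, 0; 0, 0, C]
          - !![P, 0, 0; 0, C, 0; α₃ • N, 0, Q]) ^ (p.1 : ℕ) *
        !![P, 0, 0; 0, C, 0; α₃ • N, 0, Q] ^ (p.2 : ℕ))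
      (G := fun p : Fin 2 × Fin 3 => !![C, 0, 0; 0, Q, N; 0, 0, P] ^ (p.1 : ℕ) *
        !![0, 1, 0; 0, 0, 1; α₃ • 1, 0, 0] ^ (p.2 : ℕ)) Prod.swap hli
      (fun p => ((hB.sub hA).pow p.1).mul (hA.pow p.2)) ?_
    rintro ⟨k, l⟩ ⟨k', l'⟩
    fin_cases k <;> fin_cases l <;> fin_cases k' <;> fin_cases l' <;>
      simp [C, pow_two]

/-- A model of `T(α₁, α₂, α₃)`: matrices over the algebra generated by `a`, `b` and `c`, with
respect to the basis `1, d`. -/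
theorem exists_quad {K : Type u} [Field K] (α₁ α₂ α₃ : K) :
    ∃ (R : Type u) (_ : Ring R) (_ : Algebra K R) (a b c d : R), QuadRel α₁ α₂ a b c d ∧
      (a * c + c * b + b * a - α₂ • 1) ^ 3 = α₃ • 1 ∧
      LinearIndependent K fun p : ((Fin 3 × Fin 2) × (Fin 2 × Fin 3)) × Fin 2 =>
        (((b - a) ^ (p.1.1.1 : ℕ) * a ^ (p.1.1.2 : ℕ)) *
          (c ^ (p.1.2.1 : ℕ) * (a * c + c * b + b * a - α₂ • 1) ^ (p.1.2.2 : ℕ))) *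
            d ^ (p.2 : ℕ) := by
  obtain ⟨R, _, _, a, b, c, h, hy, hli⟩ := exists_tri α₁ α₂ α₃
  have hbab := h.braid
  have hcac : c * (a * c) = α₂ • c - α₁ • b - a * (b * c) := by
    rw [mul_mul_of_mul_eq h.ca]
    simp [sub_mul, mul_assoc, h.cc]
  have haca : a * (c * a) = α₂ • a - a * (b * c) - α₁ • b := by
    simp [h.ca, mul_sub, mul_mul_of_mul_eq h.aa]
  have hcbc : c * (b * c) = α₂ • c - α₁ • a - c * (a * b) := by
    have : b * c = α₂ • 1 - c * a - a * b := by rw [h.ca]; abel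
    rw [this]
    simp [mul_sub, mul_mul_of_mul_eq h.cc]
  have hcab : c * (a * b) = α₂ • b - b * (c * b) - α₁ • a := by
    rw [mul_mul_of_mul_eq h.ca]
    simp [sub_mul, mul_assoc, h.bb]
  let A : Matrix (Fin 2) (Fin 2) R := !![a, 0; α₂ • 1 - a * c, -c]
  let B : Matrix (Fin 2) (Fin 2) R := !![b, 0; α₂ • 1 - b * a, -a]
  let C : Matrix (Fin 2) (Fin 2) R := !![c, 0; α₂ • 1 - c * b, -b]
  let D : Matrix (Fin 2) (Fin 2) R := !![0, 1; α₁ • 1, 0]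
  -- the matrix of `y` is scalar, because `y` commutes with `d`
  have hY : A * C + C * B + B * A - α₂ • 1 = !![a * c + c * b + b * a - α₂ • 1, 0; 0,
      a * c + c * b + b * a - α₂ • 1] := by
    ext i j
    fin_cases i <;> fin_cases j <;> simp [A, B, C, sub_mul, mul_sub, mul_assoc,
      h.aa, h.bb, h.cc, mul_mul_of_mul_eq h.aa, mul_mul_of_mul_eq h.bb, mul_mul_of_mul_eq h.cc]
    all_goals abel
  refine ⟨Matrix (Fin 2) (Fin 2) R, inferInstance, inferInstance, A, B, C, D,
    ⟨⟨?_, ?_, ?_, ?_⟩, ?_, ?_, ?_, ?_⟩, ?_, ?_⟩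
  · ext i j
    fin_cases i <;> fin_cases j <;> simp [A, Matrix.mul_apply, sub_mul, mul_sub, mul_assoc,
      h.aa, h.cc, haca, hcac]
    all_goals abel
  · ext i j
    fin_cases i <;> fin_cases j <;> simp [B, Matrix.mul_apply, sub_mul, mul_sub, mul_assoc,
      h.aa, h.bb, hbab]
  · ext i j
    fin_cases i <;> fin_cases j <;> simp [C, Matrix.mul_apply, sub_mul, mul_sub, mul_assoc,
      h.cc, h.bb, hcbc, hcab]
  · ext i j
    fin_cases i <;> fin_cases j <;> simp [A, B, C, Matrix.mul_apply, sub_mul, mul_sub, mul_assoc,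
      h.ca]
    all_goals abel
  · ext i j
    fin_cases i <;> fin_cases j <;> simp [D, Matrix.mul_apply]
  · ext i j
    fin_cases i <;> fin_cases j <;> simp [A, C, D, Matrix.mul_apply, sub_mul, mul_sub,
      mul_assoc, h.cc,
      mul_mul_of_mul_eq h.cc]
  · ext i j
    fin_cases i <;> fin_cases j <;> simp [A, B, D, Matrix.mul_apply, sub_mul, mul_sub,
      mul_assoc, h.aa, mul_mul_of_mul_eq h.aa]
  · ext i j
    fin_cases i <;> fin_cases j <;> simp [B, C, D, Matrix.mul_apply, sub_mul, mul_sub,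
      mul_assoc, h.bb, mul_mul_of_mul_eq h.bb]
  · rw [hY]
    ext i j
    fin_cases i <;> fin_cases j <;> simp [pow_succ, Matrix.mul_apply, ← hy]
  · rw [hY]
    have hA : ScalesBy (rowMap K (0 : Fin 2)) A a := by
      intro Z l
      simp [A, Matrix.vecMul, dotProduct]
    have hB : ScalesBy (rowMap K (0 : Fin 2)) B b := by
      intro Z l
      simp [B, Matrix.vecMul, dotProduct]
    have hC : ScalesBy (rowMap K (0 : Fin 2)) C c := by
      intro Z l
      simp [C, Matrix.vecMul, dotProduct]
    have hYs := (((hA.mul hC).add (hC.mul hB)).add (hB.mul hA)).sub (.smul_one α₂)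
    rw [hY] at hYs
    refine ScalesBy.linearIndependent (K := K)
      (f := fun p : (Fin 3 × Fin 2) × (Fin 2 × Fin 3) => ((b - a) ^ (p.1.1 : ℕ) *
        a ^ (p.1.2 : ℕ)) * (c ^ (p.2.1 : ℕ) * (a * c + c * b + b * a - α₂ • 1) ^ (p.2.2 : ℕ)))
      (F := fun p : (Fin 3 × Fin 2) × (Fin 2 × Fin 3) => ((B - A) ^ (p.1.1 : ℕ) *
        A ^ (p.1.2 : ℕ)) * (C ^ (p.2.1 : ℕ) * !![a * c + c * b + b * a - α₂ • 1, 0; 0,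
          a * c + c * b + b * a - α₂ • 1] ^ (p.2.2 : ℕ)))
      (G := fun j : Fin 2 => D ^ (j : ℕ)) id hli
      (fun p => (((hB.sub hA).pow p.1.1).mul (hA.pow p.1.2)).mul
        ((hC.pow p.2.1).mul (hYs.pow p.2.2))) ?_
    intro k l
    fin_cases k <;> fin_cases l <;> simp [D]

end Tetra

/-! ### The monomials span -/

namespace Tetra

section Tower
variable {K D : Type*} [Field K] [Ring D] [Algebra K D]

theorem mul_mem_toSubmodule_mul {S : Subalgebra K D} {E : Submodule K D} {s m : D} (hs : s ∈ S)
    (hm : m ∈ Subalgebra.toSubmodule S * E) : s * m ∈ Subalgebra.toSubmodule S * E := by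
  have h := Submodule.mul_mem_mul (M := Subalgebra.toSubmodule S) (m := s) hs hm
  rwa [← mul_assoc, (Subalgebra.isIdempotentElem_toSubmodule S).eq] at h

theorem mem_toSubmodule_mul {S : Subalgebra K D} {E : Submodule K D} {m : D} (hm : m ∈ E) :
    m ∈ Subalgebra.toSubmodule S * E := by
  have h := Submodule.mul_mem_mul (M := Subalgebra.toSubmodule S) S.one_mem hm
  rwa [one_mul] at h

/-- One stage of the tower: if right multiplication by the elements of `X` maps each `e k` into the
left `S`-module spanned by the `e k`, and this module contains `1`, then it contains the algebra
generated by `X`. -/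
theorem adjoin_le_span_mul {ι κ : Type*} (S : Subalgebra K D) {f : ι → D} {e : κ → D}
    {X : Set D} (hS : Subalgebra.toSubmodule S ≤ Submodule.span K (Set.range f)) (h1 : ∃ k, e k = 1)
    (hX : ∀ x ∈ X, ∀ k,
      e k * x ∈ Subalgebra.toSubmodule S * Submodule.span K (Set.range e)) :
    Subalgebra.toSubmodule (Algebra.adjoin K X)
      ≤ Submodule.span K (Set.range fun p : ι × κ => f p.1 * e p.2) := by
  set M := Subalgebra.toSubmodule S * Submodule.span K (Set.range e) with hM
  have hle : M ≤ Submodule.span K (Set.range fun p : ι × κ => f p.1 * e p.2) := by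
    refine (mul_le_mul' hS le_rfl).trans ?_
    rw [Submodule.span_mul_span]
    refine Submodule.span_mono ?_
    rintro _ ⟨_, ⟨i, rfl⟩, _, ⟨k, rfl⟩, rfl⟩
    exact ⟨(i, k), rfl⟩
  refine le_trans ?_ hle
  have hMX (x) (hx : x ∈ X) (m) (hm : m ∈ M) : m * x ∈ M := by
    induction hm using Submodule.mul_induction_on' with
    | mem_mul_mem s hs t ht =>
      rw [mul_assoc]
      refine mul_mem_toSubmodule_mul hs ?_
      induction ht using Submodule.span_induction with
      | mem t ht =>
        obtain ⟨k, rfl⟩ := ht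
        exact hX x hx k
      | zero => simp
      | add t t' _ _ h h' => rw [add_mul]; exact add_mem h h'
      | smul r t _ h => rw [smul_mul_assoc]; exact M.smul_mem r h
    | add m _ m' _ h h' => rw [add_mul]; exact add_mem h h'
  have hMA (z) (hz : z ∈ Algebra.adjoin K X) : ∀ m ∈ M, m * z ∈ M := by
    induction hz using Algebra.adjoin_induction with
    | mem x hx => exact hMX x hx
    | algebraMap r =>
      intro m hm
      rw [← Algebra.commutes, ← Algebra.smul_def]
      exact M.smul_mem r hm
    | add z z' _ _ h h' =>
      intro m hm
      rw [mul_add]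
      exact add_mem (h m hm) (h' m hm)
    | mul z z' _ _ h h' =>
      intro m hm
      rw [← mul_assoc]
      exact h' _ (h m hm)
  intro z hz
  obtain ⟨k, hk⟩ := h1
  have h := hMA z hz 1 (mem_toSubmodule_mul (Submodule.subset_span ⟨k, hk⟩))
  rwa [one_mul] at h

end Tower

variable {K D : Type*} [Field K] [Ring D] [Algebra K D] {α₁ α₂ α₃ : K} {a b c d : D}

theorem adjoin_singleton_le_span {w : D} {r : K} (hw : w * (w * w) = r • w) :
    Subalgebra.toSubmodule (Algebra.adjoin K {w})
      ≤ Submodule.span K (Set.range fun i : Fin 3 => w ^ (i : ℕ)) := by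
  have h := adjoin_le_span_mul (K := K) (⊥ : Subalgebra K D) (f := fun _ : Unit => 1) (X := {w})
    (e := fun i : Fin 3 => w ^ (i : ℕ)) ?_ ⟨0, by simp⟩ ?_
  · refine h.trans (Submodule.span_mono ?_)
    rintro _ ⟨p, rfl⟩
    exact ⟨p.2, by simp⟩
  · rw [Set.range_const, Algebra.toSubmodule_bot, Submodule.one_eq_span]
  · rintro x hx k
    obtain rfl : x = w := hx
    refine mem_toSubmodule_mul ?_
    rw [← pow_succ]
    fin_cases k
    · exact Submodule.subset_span ⟨1, by simp⟩
    · exact Submodule.subset_span ⟨2, by simp⟩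
    · have : x ^ 3 = r • x := by rw [← hw, pow_succ', pow_two]
      simp only [Nat.reduceAdd, this]
      exact Submodule.smul_mem _ _ (Submodule.subset_span ⟨1, by simp⟩)

theorem TriRel.adjoin_pair_le_span (h : TriRel α₁ α₂ a b c) :
    Subalgebra.toSubmodule (Algebra.adjoin K {a, b})
      ≤ Submodule.span K (Set.range fun p : Fin 3 × Fin 2 =>
          (b - a) ^ (p.1 : ℕ) * a ^ (p.2 : ℕ)) := by
  refine adjoin_le_span_mul (Algebra.adjoin K {b - a})
    (f := fun i : Fin 3 => (b - a) ^ (i : ℕ)) (e := fun j : Fin 2 => a ^ (j : ℕ))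
    (adjoin_singleton_le_span h.sub_mul_self) ⟨0, by simp⟩ ?_
  set E := Submodule.span K (Set.range fun j : Fin 2 => a ^ (j : ℕ))
  set M := Subalgebra.toSubmodule (Algebra.adjoin K {b - a}) * E
  have hw : b - a ∈ Algebra.adjoin K {b - a} := Algebra.subset_adjoin rfl
  have m1 : (1 : D) ∈ M := mem_toSubmodule_mul (Submodule.subset_span ⟨0, by simp⟩)
  have ma : a ∈ M := mem_toSubmodule_mul (Submodule.subset_span ⟨1, by simp⟩)
  have maa : a * a ∈ M := by rw [h.aa]; exact M.smul_mem _ m1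
  have mw : b - a ∈ M := by simpa using mul_mem_toSubmodule_mul hw m1
  have maw : a * (b - a) ∈ M := by
    rw [h.mul_sub_self]
    exact sub_mem (neg_mem (mul_mem_toSubmodule_mul hw ma)) (mul_mem_toSubmodule_mul hw mw)
  rintro x (rfl | rfl) k <;> fin_cases k
  · simpa using ma
  · simpa using maa
  · simpa using add_mem mw ma
  · simpa [mul_sub] using add_mem maw maa

theorem TriRel.adjoin_triple_le_span (h : TriRel α₁ α₂ a b c) {y : D}
    (hy : y = a * c + c * b + b * a - α₂ • 1) (hy3 : y ^ 3 = α₃ • 1) :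
    Subalgebra.toSubmodule (Algebra.adjoin K {a, b, c})
      ≤ Submodule.span K (Set.range fun p : (Fin 3 × Fin 2) × (Fin 2 × Fin 3) =>
          ((b - a) ^ (p.1.1 : ℕ) * a ^ (p.1.2 : ℕ)) * (c ^ (p.2.1 : ℕ) * y ^ (p.2.2 : ℕ))) := by
  refine adjoin_le_span_mul (Algebra.adjoin K {a, b})
    (f := fun p : Fin 3 × Fin 2 => (b - a) ^ (p.1 : ℕ) * a ^ (p.2 : ℕ))
    (e := fun p : Fin 2 × Fin 3 => c ^ (p.1 : ℕ) * y ^ (p.2 : ℕ))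
    h.adjoin_pair_le_span ⟨(0, 0), by simp⟩ ?_
  set S := Algebra.adjoin K {a, b}
  set E := Submodule.span K (Set.range fun p : Fin 2 × Fin 3 => c ^ (p.1 : ℕ) * y ^ (p.2 : ℕ))
  set M := Subalgebra.toSubmodule S * E
  have ha : a ∈ S := Algebra.subset_adjoin (by simp)
  have hb : b ∈ S := Algebra.subset_adjoin (by simp)
  have my (l : ℕ) (hl : l < 3) : y ^ l ∈ M :=
    mem_toSubmodule_mul (Submodule.subset_span ⟨(0, ⟨l, hl⟩), by simp⟩)
  have mcy (l : ℕ) (hl : l < 3) : c * y ^ l ∈ M :=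
    mem_toSubmodule_mul (Submodule.subset_span ⟨(1, ⟨l, hl⟩), by simp⟩)
  have my' (l : ℕ) (hl : l < 3) : y ^ (l + 1) ∈ M := by
    obtain hl | rfl : l + 1 < 3 ∨ l = 2 := by omega
    · exact my _ hl
    · rw [hy3]
      exact M.smul_mem _ (by simpa using my 0 (by norm_num))
  have key (t : D) (ht : t ∈ ({a, b, c} : Set D)) (k : Fin 2) (l : ℕ) (hl : l < 3) :
      c ^ (k : ℕ) * (t * y ^ l) ∈ M := by
    rcases ht with rfl | rfl | rfl <;> fin_cases k
    · simpa using mul_mem_toSubmodule_mul ha (my l hl)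
    · simp only [pow_one, mul_mul_of_mul_eq h.ca, sub_mul, mul_assoc,
        smul_mul_assoc, one_mul]
      exact sub_mem (sub_mem (M.smul_mem _ (my l hl)) (mul_mem_toSubmodule_mul hb (mcy l hl)))
        (mul_mem_toSubmodule_mul ha (mul_mem_toSubmodule_mul hb (my l hl)))
    · simpa using mul_mem_toSubmodule_mul hb (my l hl)
    · simp only [pow_one, mul_mul_of_mul_eq (TriRel.c_mul_b hy), sub_mul,
        add_mul, mul_assoc, smul_mul_assoc, one_mul, ← pow_succ']
      exact sub_mem (sub_mem (add_mem (my' l hl) (M.smul_mem _ (my l hl)))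
        (mul_mem_toSubmodule_mul ha (mcy l hl)))
        (mul_mem_toSubmodule_mul hb (mul_mem_toSubmodule_mul ha (my l hl)))
    · simpa using mcy l hl
    · simp only [pow_one, mul_mul_of_mul_eq h.cc, smul_mul_assoc, one_mul]
      exact M.smul_mem _ (my l hl)
  -- powers of `y` move past `a`, `b`, `c` and permute them
  have hcomm (l : ℕ) : ∀ x ∈ ({a, b, c} : Set D), ∃ t ∈ ({a, b, c} : Set D),
      y ^ l * x = t * y ^ l := by
    induction l with
    | zero => exact fun x hx => ⟨x, hx, by simp⟩
    | succ l ih =>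
      have step : ∀ x ∈ ({a, b, c} : Set D), ∃ t ∈ ({a, b, c} : Set D), y * x = t * y := by
        rintro x (rfl | rfl | rfl)
        · exact ⟨c, by simp, h.y_mul_a hy⟩
        · exact ⟨a, by simp, h.y_mul_b hy⟩
        · exact ⟨b, by simp, h.y_mul_c hy⟩
      intro x hx
      obtain ⟨t, ht, h1⟩ := step x hx
      obtain ⟨t', ht', h2⟩ := ih t ht
      exact ⟨t', ht', by rw [pow_succ, mul_assoc, h1, ← mul_assoc, h2, mul_assoc]⟩
  rintro x hx ⟨k, l⟩
  obtain ⟨t, ht, h1⟩ := hcomm l x hx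
  rw [mul_assoc, h1]
  exact key t ht k l l.2

theorem QuadRel.adjoin_le_span (h : QuadRel α₁ α₂ a b c d) {y : D}
    (hy : y = a * c + c * b + b * a - α₂ • 1) (hy3 : y ^ 3 = α₃ • 1) :
    Subalgebra.toSubmodule (Algebra.adjoin K {a, b, c, d})
      ≤ Submodule.span K (Set.range fun p : ((Fin 3 × Fin 2) × (Fin 2 × Fin 3)) × Fin 2 =>
          (((b - a) ^ (p.1.1.1 : ℕ) * a ^ (p.1.1.2 : ℕ)) *
            (c ^ (p.1.2.1 : ℕ) * y ^ (p.1.2.2 : ℕ))) * d ^ (p.2 : ℕ)) := by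
  refine adjoin_le_span_mul (Algebra.adjoin K {a, b, c})
    (f := fun p : (Fin 3 × Fin 2) × (Fin 2 × Fin 3) =>
      ((b - a) ^ (p.1.1 : ℕ) * a ^ (p.1.2 : ℕ)) * (c ^ (p.2.1 : ℕ) * y ^ (p.2.2 : ℕ)))
    (e := fun j : Fin 2 => d ^ (j : ℕ)) (h.adjoin_triple_le_span hy hy3) ⟨0, by simp⟩ ?_
  set S := Algebra.adjoin K {a, b, c}
  set E := Submodule.span K (Set.range fun j : Fin 2 => d ^ (j : ℕ))
  set M := Subalgebra.toSubmodule S * E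
  have ha : a ∈ S := Algebra.subset_adjoin (by simp)
  have hb : b ∈ S := Algebra.subset_adjoin (by simp)
  have hc : c ∈ S := Algebra.subset_adjoin (by simp)
  have m1 : (1 : D) ∈ M := mem_toSubmodule_mul (Submodule.subset_span ⟨0, by simp⟩)
  have md : d ∈ M := mem_toSubmodule_mul (Submodule.subset_span ⟨1, by simp⟩)
  have mS (s : D) (hs : s ∈ S) : s ∈ M := by simpa using mul_mem_toSubmodule_mul hs m1
  have mα : α₂ • (1 : D) ∈ M := M.smul_mem _ m1
  rintro x (rfl | rfl | rfl | rfl) k <;> fin_cases k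
  · simpa using mS _ ha
  · simp only [pow_one, h.da]
    exact sub_mem (sub_mem mα (mul_mem_toSubmodule_mul hc md)) (mS _ (mul_mem ha hc))
  · simpa using mS _ hb
  · simp only [pow_one, h.db]
    exact sub_mem (sub_mem mα (mS _ (mul_mem hb ha))) (mul_mem_toSubmodule_mul ha md)
  · simpa using mS _ hc
  · simp only [pow_one, h.dc]
    exact sub_mem (sub_mem mα (mS _ (mul_mem hc hb))) (mul_mem_toSubmodule_mul hb md)
  · simpa using md
  · simp only [pow_one, h.dd]
    exact M.smul_mem _ m1

end Tetra

/-! ### The action of the group -/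

namespace Tetra

section Symmetry
variable {K D : Type*} [Field K] [Ring D] [Algebra K D] {α₁ α₂ α₃ : K} {a b c d : D}

theorem QuadRel.act_a (h : QuadRel α₁ α₂ a b c d) : QuadRel α₁ α₂ (-a) (-c) (-d) (-b) := by
  refine ⟨⟨?_, ?_, ?_, ?_⟩, ?_, ?_, ?_, ?_⟩ <;>
    simp only [neg_mul_neg, h.aa, h.bb, h.cc, h.dd, h.ca, h.da, h.db, h.dc]
  all_goals abel

theorem QuadRel.act_b (h : QuadRel α₁ α₂ a b c d) : QuadRel α₁ α₂ (-d) (-b) (-a) (-c) := by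
  refine ⟨⟨?_, ?_, ?_, ?_⟩, ?_, ?_, ?_, ?_⟩ <;>
    simp only [neg_mul_neg, h.aa, h.bb, h.cc, h.dd, h.ca, h.da, h.db, h.dc]
  all_goals abel

theorem QuadRel.act_c (h : QuadRel α₁ α₂ a b c d) : QuadRel α₁ α₂ (-b) (-d) (-c) (-a) := by
  refine ⟨⟨?_, ?_, ?_, ?_⟩, ?_, ?_, ?_, ?_⟩ <;>
    simp only [neg_mul_neg, h.aa, h.bb, h.cc, h.dd, h.ca, h.da, h.db, h.dc]
  all_goals abel

theorem QuadRel.act_d (h : QuadRel α₁ α₂ a b c d) : QuadRel α₁ α₂ (-c) (-a) (-b) (-d) := by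
  refine ⟨⟨?_, ?_, ?_, ?_⟩, ?_, ?_, ?_, ?_⟩ <;>
    simp only [neg_mul_neg, h.aa, h.bb, h.cc, h.dd, h.ca, h.da, h.db, h.dc]
  all_goals abel

variable {s : Gen → D}

theorem QuadRel.act (h : QuadRel α₁ α₂ (s .a) (s .b) (s .c) (s .d)) (x : Gen) :
    QuadRel α₁ α₂ (-s (op x .a)) (-s (op x .b)) (-s (op x .c)) (-s (op x .d)) :=
  match x with
  | .a => h.act_a
  | .b => h.act_b
  | .c => h.act_c
  | .d => h.act_d

/-- The cubic relation is stable under the action. The four triples of generators are related by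
the cyclic permutation of `a`, `b`, `c` that fixes `d`, so `QuadRel.cube_eq` covers all of them. -/
theorem QuadRel.cube_act (h : QuadRel α₁ α₂ (s .a) (s .b) (s .c) (s .d)) (x : Gen) :
    (-s (op x .a) * -s (op x .c) + -s (op x .c) * -s (op x .b) + -s (op x .b) * -s (op x .a)
      - α₂ • 1) ^ 3 = (s .a * s .c + s .c * s .b + s .b * s .a - α₂ • 1) ^ 3 := by
  have hd : (-s .c * -s .b + -s .b * -s .a + -s .a * -s .c - α₂ • 1) ^ 3
      = (s .a * s .c + s .c * s .b + s .b * s .a - α₂ • 1) ^ 3 := by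
    congr 2
    simp only [neg_mul_neg]
    abel
  have h1 := h.cube_eq rfl
  have h2 := h.act_d.cube_eq rfl
  have h3 := h.act_d.act_d.cube_eq rfl
  rw [hd] at h2
  simp only [neg_neg] at h3
  have hd2 : (s .b * s .a + s .a * s .c + s .c * s .b - α₂ • 1) ^ 3
      = (s .a * s .c + s .c * s .b + s .b * s .a - α₂ • 1) ^ 3 := by
    congr 2
    abel
  rw [hd2] at h3
  cases x
  · rw [← h1]
    congr 2
    simp only [op, neg_mul_neg]
    abel
  · rw [← h3]
    congr 2
    simp only [op, neg_mul_neg]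
  · rw [← h2]
    congr 2
    simp only [op, neg_mul_neg]
    abel
  · exact hd

theorem sum_pow_six (h : QuadRel (0 : K) 0 a b c d) :
    (a + b + c) ^ 6 = (a * c + c * b + b * a - (0 : K) • 1) ^ 3 := by
  rw [show 6 = 2 * 3 from rfl, pow_mul, h.sum_sq]
  simp

theorem op_iterate_three (x z : Gen) : op x (op x (op x z)) = z := by
  cases x <;> cases z <;> rfl

/-- The permutation of the generators by which `g x` acts, up to sign. -/
def opPerm (x : Gen) : Equiv.Perm Gen where
  toFun := op x
  invFun z := op x (op x z)
  left_inv := op_iterate_three x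
  right_inv := op_iterate_three x

/-- If each `g x` acts by an algebra endomorphism, then `G` acts by automorphisms: these
endomorphisms have order dividing six, and the relations of `G` may be checked on the generators. -/
theorem exists_action (hs : Algebra.adjoin K (Set.range s) = ⊤)
    (hf : ∀ x, ∃ f : D →ₐ[K] D, ∀ z, f (s z) = -s (op x z)) :
    ∃ ρ : G →* (D ≃ₐ[K] D), ∀ x z, ρ (g x) (s z) = -s (op x z) := by
  choose f hf using hf
  have hf6 (x : Gen) : f x ^ 6 = 1 := by
    refine AlgHom.ext_of_adjoin_eq_top hs ?_
    rintro _ ⟨z, rfl⟩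
    simp [pow_succ, hf, op_iterate_three]
  let F (x : Gen) : D ≃ₐ[K] D := AlgEquiv.ofAlgHom (f x) (f x ^ 5)
    ((pow_succ' (f x) 5).symm.trans (hf6 x)) ((pow_succ (f x) 5).symm.trans (hf6 x))
  have hF (x z) : F x (s z) = -s (op x z) := hf x z
  refine ⟨PresentedGroup.toGroup (f := F) ?_, fun x z => ?_⟩
  · rintro _ ⟨u, v, huv, rfl⟩
    rw [map_mul, map_inv, mul_inv_eq_one]
    refine AlgEquiv.coe_toAlgHom_injective (AlgHom.ext_of_adjoin_eq_top hs ?_)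
    rintro _ ⟨z, rfl⟩
    cases huv <;> cases z <;> simp [hF, op]
  · rw [g, PresentedGroup.toGroup.of]
    exact hF x z

/-- Each element of `G` permutes the generators of two algebras in the same way, up to a common
scalar. -/
theorem exists_perm_sign {D' : Type*} [Ring D'] [Algebra K D'] {s' : Gen → D'}
    {ρ : G →* (D ≃ₐ[K] D)} {ρ' : G →* (D' ≃ₐ[K] D')}
    (hρ : ∀ x z, ρ (g x) (s z) = -s (op x z)) (hρ' : ∀ x z, ρ' (g x) (s' z) = -s' (op x z))
    (w : G) : ∃ (π : Equiv.Perm Gen) (ε : Kˣ), (∀ z, ρ w (s z) = (ε : K) • s (π z)) ∧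
      ∀ z, ρ' w (s' z) = (ε : K) • s' (π z) := by
  have hw : w ∈ Subgroup.closure (Set.range (PresentedGroup.of (rels := {w : FreeGroup Gen |
      ∃ u v, GroupRel u v ∧ w = u * v⁻¹}))) := by
    rw [PresentedGroup.closure_range_of]
    trivial
  induction hw using Subgroup.closure_induction with
  | mem w hw =>
    obtain ⟨x, rfl⟩ := hw
    exact ⟨opPerm x, -1, fun z => (hρ x z).trans (by simp [opPerm]),
      fun z => (hρ' x z).trans (by simp [opPerm])⟩
  | one => exact ⟨1, 1, by simp, by simp⟩
  | mul v w _ _ hv hw =>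
    obtain ⟨π, ε, h1, h2⟩ := hv
    obtain ⟨π', ε', h1', h2'⟩ := hw
    exact ⟨π * π', ε * ε', fun z => by simp [h1, h1', smul_smul, mul_comm],
      fun z => by simp [h2, h2', smul_smul, mul_comm]⟩
  | inv w _ hw =>
    obtain ⟨π, ε, h1, h2⟩ := hw
    refine ⟨π⁻¹, ε⁻¹, fun z => (ρ w).injective ?_, fun z => (ρ' w).injective ?_⟩
    · rw [map_smul, h1, ← AlgEquiv.mul_apply, ← map_mul]
      simp
    · rw [map_smul, h2, ← AlgEquiv.mul_apply, ← map_mul]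
      simp

end Symmetry

/-! ### Universal properties of the two presentations -/

section Presentations
variable (K : Type*) [Field K]

theorem bRel_eq {u : FreeAlgebra K Gen} (h : BRel K u 0) : RingQuot.mkAlgHom K (BRel K) u = 0 := by
  rw [RingQuot.mkAlgHom_rel K h, map_zero]

theorem quadRel_bgen : QuadRel (0 : K) 0 (bgen K .a) (bgen K .b) (bgen K .c) (bgen K .d) := by
  have aa := bRel_eq K .aa
  have bb := bRel_eq K .bb
  have cc := bRel_eq K .cc
  have dd := bRel_eq K .dd
  have h1 := bRel_eq K .abc
  have h2 := bRel_eq K .acd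
  have h3 := bRel_eq K .adb
  have h4 := bRel_eq K .bdc
  simp only [map_add, map_mul, pow_two] at aa bb cc dd h1 h2 h3 h4
  refine ⟨⟨?_, ?_, ?_, ?_⟩, ?_, ?_, ?_, ?_⟩ <;> rw [zero_smul]
  · exact aa
  · exact bb
  · exact cc
  · rw [sub_sub, zero_sub, eq_neg_iff_add_eq_zero, ← h1, bgen, bgen, bgen]; abel
  · exact dd
  · rw [sub_sub, zero_sub, eq_neg_iff_add_eq_zero, ← h2, bgen, bgen, bgen]; abel
  · rw [sub_sub, zero_sub, eq_neg_iff_add_eq_zero, ← h3, bgen, bgen, bgen]; abel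
  · rw [sub_sub, zero_sub, eq_neg_iff_add_eq_zero, ← h4, bgen, bgen, bgen]; abel

theorem bgen_sum_pow_six : (bgen K .a + bgen K .b + bgen K .c) ^ 6 = 0 := by
  have h := bRel_eq K .six
  rw [map_pow, map_add, map_add] at h
  exact h

variable {K}

/-- The universal property of `B`, for a target that need not have a subtraction. -/
theorem exists_bHom_of_semiring {D : Type*} [Semiring D] [Algebra K D] {s : Gen → D}
    (hsq : ∀ z, s z * s z = 0)
    (abc : s .a * s .b + s .b * s .c + s .c * s .a = 0)
    (acd : s .a * s .c + s .c * s .d + s .d * s .a = 0)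
    (adb : s .a * s .d + s .b * s .a + s .d * s .b = 0)
    (bdc : s .b * s .d + s .c * s .b + s .d * s .c = 0)
    (six : (s .a + s .b + s .c) ^ 6 = 0) :
    ∃ f : B K →ₐ[K] D, ∀ z, f (bgen K z) = s z := by
  refine ⟨RingQuot.liftAlgHom K ⟨FreeAlgebra.lift K s, fun u v huv => ?_⟩, fun z => ?_⟩
  · cases huv <;> simp [pow_two, hsq, abc, acd, adb, bdc, six]
  · rw [bgen, RingQuot.liftAlgHom_mkAlgHom_apply, FreeAlgebra.lift_ι_apply]

theorem exists_bHom {D : Type*} [Ring D] [Algebra K D] {s : Gen → D}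
    (h : QuadRel (0 : K) 0 (s .a) (s .b) (s .c) (s .d)) (h6 : (s .a + s .b + s .c) ^ 6 = 0) :
    ∃ f : B K →ₐ[K] D, ∀ z, f (bgen K z) = s z := by
  refine exists_bHom_of_semiring (fun z => ?_) ?_ ?_ ?_ ?_ h6
  · cases z <;> simp [h.aa, h.bb, h.cc, h.dd]
  · rw [h.ca, zero_smul]; abel
  · rw [h.da, zero_smul]; abel
  · rw [h.db, zero_smul]; abel
  · rw [h.dc, zero_smul]; abel

variable (α₁ α₂ α₃ : K)

theorem tRel_eq {u : FreeAlgebra K Gen} {r : K}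
    (h : TRel α₁ α₂ α₃ (u - algebraMap K _ r) 0) :
    RingQuot.mkAlgHom K (TRel α₁ α₂ α₃) u = r • 1 := by
  have := RingQuot.mkAlgHom_rel K h
  rwa [map_sub, AlgHom.commutes, map_zero, sub_eq_zero, Algebra.algebraMap_eq_smul_one] at this

theorem quadRel_tgen : QuadRel α₁ α₂ (tgen α₁ α₂ α₃ .a) (tgen α₁ α₂ α₃ .b) (tgen α₁ α₂ α₃ .c)
    (tgen α₁ α₂ α₃ .d) := by
  have aa := tRel_eq α₁ α₂ α₃ .aa
  have bb := tRel_eq α₁ α₂ α₃ .bb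
  have cc := tRel_eq α₁ α₂ α₃ .cc
  have dd := tRel_eq α₁ α₂ α₃ .dd
  have h1 := tRel_eq α₁ α₂ α₃ .cab
  have h2 := tRel_eq α₁ α₂ α₃ .dac
  have h3 := tRel_eq α₁ α₂ α₃ .dba
  have h4 := tRel_eq α₁ α₂ α₃ .dcb
  simp only [map_add, map_mul, pow_two] at aa bb cc dd h1 h2 h3 h4
  refine ⟨⟨aa, bb, cc, ?_⟩, dd, ?_, ?_, ?_⟩ <;> simp only [tgen]
  · rw [← h1]; abel
  · rw [← h2]; abel
  · rw [← h3]; abel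
  · rw [← h4]; abel

theorem y_eq : y α₁ α₂ α₃ = tgen α₁ α₂ α₃ .a * tgen α₁ α₂ α₃ .c
    + tgen α₁ α₂ α₃ .c * tgen α₁ α₂ α₃ .b + tgen α₁ α₂ α₃ .b * tgen α₁ α₂ α₃ .a - α₂ • 1 := by
  rw [y, Algebra.algebraMap_eq_smul_one]

theorem y_pow_three : y α₁ α₂ α₃ ^ 3 = α₃ • 1 := by
  have h := tRel_eq α₁ α₂ α₃ .six
  simp only [map_add, map_mul, map_pow, map_sub, AlgHom.commutes] at h
  rw [← h, y]
  simp only [tgen]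
  congr 2
  abel

variable {α₁ α₂ α₃}

theorem exists_tHom {D : Type*} [Ring D] [Algebra K D] {s : Gen → D}
    (h : QuadRel α₁ α₂ (s .a) (s .b) (s .c) (s .d))
    (h3 : (s .a * s .c + s .c * s .b + s .b * s .a - α₂ • 1) ^ 3 = α₃ • 1) :
    ∃ f : T α₁ α₂ α₃ →ₐ[K] D, ∀ z, f (tgen α₁ α₂ α₃ z) = s z := by
  have h3' : (s .c * s .b + s .b * s .a + s .a * s .c - α₂ • 1) ^ 3 = α₃ • 1 := by
    rw [← h3]
    congr 2
    abel
  refine ⟨RingQuot.liftAlgHom K ⟨FreeAlgebra.lift K s, fun u v huv => ?_⟩, fun z => ?_⟩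
  · cases huv <;> simp only [map_sub, map_add, map_mul, map_pow, map_smul, map_one,
      FreeAlgebra.lift_ι_apply, Algebra.algebraMap_eq_smul_one, map_zero, h3', sub_self]
    all_goals simp only [pow_two, h.aa, h.bb, h.cc, h.dd, h.ca, h.da, h.db, h.dc]
    all_goals abel
  · rw [tgen, RingQuot.liftAlgHom_mkAlgHom_apply, FreeAlgebra.lift_ι_apply]

variable (K)

theorem adjoin_bgen : Algebra.adjoin K (Set.range (bgen K)) = ⊤ := adjoin_ringQuot (BRel K)

theorem exists_action_B : ∃ ρ : G →* (B K ≃ₐ[K] B K),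
    ∀ x z, ρ (g x) (bgen K z) = -bgen K (op x z) := by
  refine exists_action (adjoin_bgen K) fun x => ?_
  have h := quadRel_bgen K
  refine exists_bHom (s := fun z => -bgen K (op x z)) (h.act x) ?_
  rw [sum_pow_six (h.act x), h.cube_act x, ← sum_pow_six h, bgen_sum_pow_six]

variable {K} (α₁ α₂ α₃)

theorem adjoin_tgen : Algebra.adjoin K (Set.range (tgen α₁ α₂ α₃)) = ⊤ :=
  adjoin_ringQuot (TRel α₁ α₂ α₃)

theorem exists_action_T : ∃ ρ : G →* (T α₁ α₂ α₃ ≃ₐ[K] T α₁ α₂ α₃),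
    ∀ x z, ρ (g x) (tgen α₁ α₂ α₃ z) = -tgen α₁ α₂ α₃ (op x z) := by
  refine exists_action (adjoin_tgen α₁ α₂ α₃) fun x => ?_
  have h := quadRel_tgen α₁ α₂ α₃
  refine exists_tHom (s := fun z => -tgen α₁ α₂ α₃ (op x z)) (h.act x) ?_
  rw [h.cube_act x, ← y_eq, y_pow_three]

end Presentations
end Tetra

/-! ### Symbols in the associated graded algebra -/

namespace AlgFiltration
variable {K D : Type*} [Field K] [Ring D] [Algebra K D] (f : AlgFiltration K D)

/-- `u` is the class of `x ∈ F n` in degree `n` of `gr D`. As a relation it needs no transport along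
equalities of degrees. -/
def IsSymb (n : ℕ) (x : D) (u : f.gr) : Prop := ∃ hx : x ∈ f.F n, f.symb n ⟨x, hx⟩ = u

variable {f}

theorem le_low {m n : ℕ} (h : m < n) : f.F m ≤ f.low n := by
  cases n with
  | zero => omega
  | succ n => exact f.mono (by omega)

theorem low_le (n : ℕ) : f.low n ≤ f.F n := by
  cases n with
  | zero => exact bot_le
  | succ n => exact f.mono (by omega)

theorem isSymb_symb {n : ℕ} (x : f.F n) : f.IsSymb n x (f.symb n x) := ⟨x.2, rfl⟩

theorem isSymb_zero_of_mem_low {n : ℕ} {x : D} (h : x ∈ f.low n) : f.IsSymb n x 0 := by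
  refine ⟨low_le n h, ?_⟩
  rw [symb, LinearMap.comp_apply, f.cls_eq_zero h, map_zero]

namespace IsSymb
variable {n m : ℕ} {x x' : D} {u u' : f.gr}

theorem unique (h : f.IsSymb n x u) (h' : f.IsSymb n x u') : u = u' := by
  obtain ⟨_, rfl⟩ := h
  exact h'.2

theorem add (h : f.IsSymb n x u) (h' : f.IsSymb n x' u') : f.IsSymb n (x + x') (u + u') := by
  obtain ⟨hx, rfl⟩ := h
  obtain ⟨hx', rfl⟩ := h'
  exact ⟨add_mem hx hx', map_add (f.symb n) ⟨x, hx⟩ ⟨x', hx'⟩⟩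

theorem smul (r : K) (h : f.IsSymb n x u) : f.IsSymb n (r • x) (r • u) := by
  obtain ⟨hx, rfl⟩ := h
  exact ⟨Submodule.smul_mem _ r hx, map_smul (f.symb n) r ⟨x, hx⟩⟩

/-- Compatibility with subtraction, for classes in the image of a linear map: `gr D` carries only a
semiring structure. -/
theorem sub {D' : Type*} [Ring D'] [Algebra K D'] (φ : D' →ₗ[K] f.gr) {v v' : D'}
    (h : f.IsSymb n x (φ v)) (h' : f.IsSymb n x' (φ v')) : f.IsSymb n (x - x') (φ (v - v')) := by
  have h1 := h.add (h'.smul (-1))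
  rwa [← map_smul, ← map_add, neg_one_smul, neg_one_smul, ← sub_eq_add_neg,
    ← sub_eq_add_neg] at h1

theorem sum {ι : Type*} (t : Finset ι) {x : ι → D} {u : ι → f.gr}
    (h : ∀ i ∈ t, f.IsSymb n (x i) (u i)) : f.IsSymb n (∑ i ∈ t, x i) (∑ i ∈ t, u i) := by
  classical
  induction t using Finset.induction_on with
  | empty => exact isSymb_zero_of_mem_low (by simp)
  | insert i t hi ih =>
    rw [Finset.sum_insert hi, Finset.sum_insert hi]
    exact (h i (by simp)).add (ih fun j hj => h j (by simp [hj]))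

theorem mul (h : f.IsSymb m x u) (h' : f.IsSymb n x' u') :
    f.IsSymb (m + n) (x * x') (u * u') := by
  obtain ⟨hx, rfl⟩ := h
  obtain ⟨hx', rfl⟩ := h'
  exact ⟨f.mul_mem hx hx',
    (DirectSum.of_mul_of (A := f.Gr) (f.cls m ⟨x, hx⟩) (f.cls n ⟨x', hx'⟩)).symm⟩

theorem one : f.IsSymb 0 1 1 := ⟨f.one_mem, rfl⟩

theorem pow (h : f.IsSymb m x u) (k : ℕ) : f.IsSymb (m * k) (x ^ k) (u ^ k) := by
  induction k with
  | zero => simpa using one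
  | succ k ih =>
    rw [pow_succ, pow_succ, Nat.mul_succ]
    exact ih.mul h

theorem eq_zero (h : f.IsSymb n x u) (hx : x ∈ f.low n) : u = 0 :=
  h.unique (isSymb_zero_of_mem_low hx)

theorem mem_low (h : f.IsSymb n x 0) : x ∈ f.low n := by
  obtain ⟨hx, h0⟩ := h
  rw [symb, LinearMap.comp_apply] at h0
  have h1 : f.cls n ⟨x, hx⟩ = 0 :=
    DirectSum.of_injective (β := f.Gr) n (h0.trans (map_zero _).symm)
  rw [cls, Submodule.mkQ_apply, Submodule.Quotient.mk_eq_zero] at h1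
  exact h1

end IsSymb

theorem gr_induction {p : f.gr → Prop} (h0 : p 0) (hadd : ∀ u v, p u → p v → p (u + v))
    (hsymb : ∀ n x u, f.IsSymb n x u → p u) (u : f.gr) : p u := by
  induction u using DirectSum.induction_on with
  | zero => exact h0
  | of n z =>
    obtain ⟨x, hx, rfl⟩ := f.cls_surjective n z
    exact hsymb n x _ ⟨hx, rfl⟩
  | add u v hu hv => exact hadd u v hu hv

/-- A linear form on `D` that vanishes on `F (n - 1)` induces one on the degree `n` part of `gr D`,
extended by zero. -/
theorem exists_linearMap_gr (n : ℕ) (l : D →ₗ[K] K) (hl : ∀ x ∈ f.low n, l x = 0) :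
    ∃ L : f.gr →ₗ[K] K, ∀ m x u, f.IsSymb m x u → L u = if m = n then l x else 0 := by
  refine ⟨DirectSum.toModule K ℕ K fun m => Submodule.liftQ _
    ((if m = n then l else 0) ∘ₗ (f.F m).subtype) ?_, ?_⟩
  · rintro ⟨x, hx⟩ hx'
    replace hx' : x ∈ f.low m := hx'
    rw [LinearMap.mem_ker]
    by_cases h : m = n
    · subst h
      simpa using hl x hx'
    · simp [h]
  · rintro m x _ ⟨hx, rfl⟩
    rw [symb, LinearMap.comp_apply, DirectSum.toModule_lof, cls, Submodule.mkQ_apply,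
      Submodule.liftQ_apply]
    by_cases h : m = n <;> simp [h]

end AlgFiltration

/-! ### Word degree and PBW monomials -/

namespace Tetra
universe u

section Words
variable {K A X : Type*} [Field K] [Ring A] [Algebra K A] {s : X → A}

theorem word_mem_wordsEq (l : List X) : (l.map s).prod ∈ wordsEq K s l.length :=
  Submodule.subset_span ⟨l, rfl, rfl⟩

theorem gen_mem_wordsEq (x : X) : s x ∈ wordsEq K s 1 :=
  Submodule.subset_span ⟨[x], rfl, by simp⟩

theorem one_mem_wordsEq : (1 : A) ∈ wordsEq K s 0 := Submodule.subset_span ⟨[], rfl, rfl⟩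

theorem wordsEq_mul_mem {i j : ℕ} {x y : A} (hx : x ∈ wordsEq K s i)
    (hy : y ∈ wordsEq K s j) : x * y ∈ wordsEq K s (i + j) := by
  have h := Submodule.mul_mem_mul hx hy
  rw [wordsEq, wordsEq, Submodule.span_mul_span] at h
  refine Submodule.span_mono ?_ h
  rintro z ⟨_, ⟨l, hl, rfl⟩, _, ⟨l', hl', rfl⟩, rfl⟩
  exact ⟨l ++ l', by rw [List.length_append, hl, hl'], by simp⟩

theorem wordsEq_pow_mem {i : ℕ} {x : A} (hx : x ∈ wordsEq K s i) (k : ℕ) :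
    x ^ k ∈ wordsEq K s (i * k) := by
  induction k with
  | zero => simpa using one_mem_wordsEq
  | succ k ih =>
    rw [pow_succ, Nat.mul_succ]
    exact wordsEq_mul_mem ih hx

theorem map_word {F A' : Type*} [Ring A'] [Algebra K A'] [FunLike F A A'] [AlgHomClass F K A A']
    {s' : X → A'} {φ : F} {π : X → X} {r : K}
    (h : ∀ x, φ (s x) = r • s' (π x)) (l : List X) :
    φ (l.map s).prod = r ^ l.length • ((l.map π).map s').prod := by
  induction l with
  | nil => simp
  | cons x l ih =>
    simp only [List.map_cons, List.prod_cons, map_mul, ih, h, List.length_cons, pow_succ',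
      smul_mul_smul_comm]

end Words

variable (K : Type*) [Field K]

/-- The exponents `(n₁, n₂, n₃, n₄, n₅)` of the PBW monomials. -/
abbrev Idx : Type := Fin 3 × Fin 2 × Fin 2 × Fin 3 × Fin 2

/-- The word degree of the PBW monomial with the given exponents; `y` has degree two. -/
def deg (p : Idx) : ℕ := p.1 + p.2.1 + p.2.2.1 + 2 * p.2.2.2.1 + p.2.2.2.2

/-- The monomial `(b - a) ^ n₁ * a ^ n₂ * c ^ n₃ * y ^ n₄ * d ^ n₅`. -/
def mon {D : Type*} [Ring D] (a b c d y : D) (p : Idx) : D :=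
  (b - a) ^ (p.1 : ℕ) * a ^ (p.2.1 : ℕ) * c ^ (p.2.2.1 : ℕ) * y ^ (p.2.2.2.1 : ℕ) *
    d ^ (p.2.2.2.2 : ℕ)

theorem mon_mem_wordsEq {D X : Type*} [Ring D] [Algebra K D] {s : X → D} {a b c d y : D}
    (ha : a ∈ wordsEq K s 1) (hb : b ∈ wordsEq K s 1) (hc : c ∈ wordsEq K s 1)
    (hd : d ∈ wordsEq K s 1) (hy : y ∈ wordsEq K s 2) (p : Idx) :
    mon a b c d y p ∈ wordsEq K s (deg p) := by
  have hpow (x : D) (hx : x ∈ wordsEq K s 1) (k : ℕ) : x ^ k ∈ wordsEq K s k := by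
    simpa only [one_mul] using wordsEq_pow_mem hx k
  exact wordsEq_mul_mem (wordsEq_mul_mem (wordsEq_mul_mem (wordsEq_mul_mem
    (hpow _ (sub_mem hb ha) _) (hpow _ ha _)) (hpow _ hc _)) (wordsEq_pow_mem hy _)) (hpow _ hd _)

theorem map_mon {D D' : Type*} [Ring D] [Ring D'] (f : D →+* D') (a b c d y : D) (p : Idx) :
    f (mon a b c d y p) = mon (f a) (f b) (f c) (f d) (f y) p := by
  simp [mon]

theorem nested_mon_eq {D : Type*} [Ring D] (a b c d y : D)
    (p : ((Fin 3 × Fin 2) × (Fin 2 × Fin 3)) × Fin 2) :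
    (((b - a) ^ (p.1.1.1 : ℕ) * a ^ (p.1.1.2 : ℕ)) *
      (c ^ (p.1.2.1 : ℕ) * y ^ (p.1.2.2 : ℕ))) * d ^ (p.2 : ℕ)
      = mon a b c d y (p.1.1.1, p.1.1.2, p.1.2.1, p.1.2.2, p.2) := by
  simp [mon, mul_assoc]

variable {K}

/-- The PBW monomials are independent in any algebra that maps to every algebra in which the
relations of `T(α₁, α₂, α₃)` hold. -/
theorem linearIndependent_mon_of_hom {K : Type u} [Field K] {D : Type*} [Ring D] [Algebra K D]
    {α₁ α₂ α₃ : K} (s : Gen → D) (hom : ∀ (R : Type u) [Ring R] [Algebra K R] (t : Gen → R),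
      QuadRel α₁ α₂ (t .a) (t .b) (t .c) (t .d) →
      (t .a * t .c + t .c * t .b + t .b * t .a - α₂ • 1) ^ 3 = α₃ • 1 →
      ∃ f : D →ₐ[K] R, ∀ z, f (s z) = t z) :
    LinearIndependent K (mon (s .a) (s .b) (s .c) (s .d)
      (s .a * s .c + s .c * s .b + s .b * s .a - α₂ • 1)) := by
  obtain ⟨R, _, _, a, b, c, d, hq, h3, hli⟩ := exists_quad α₁ α₂ α₃
  obtain ⟨f, hf⟩ := hom R (fun z => match z with | .a => a | .b => b | .c => c | .d => d) hq h3
  refine LinearIndependent.of_comp f.toLinearMap ?_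
  have h1 := hli.comp (fun p : Idx => (((p.1, p.2.1), (p.2.2.1, p.2.2.2.1)), p.2.2.2.2))
    (fun p q h => by simp only [Prod.mk.injEq] at h; ext <;> simp [h])
  convert h1 using 1
  funext p
  simp only [Function.comp_apply, nested_mon_eq]
  rw [AlgHom.toLinearMap_apply, ← AlgHom.coe_toRingHom, map_mon]
  simp [hf]

theorem QuadRel.span_mon_eq_top {D : Type*} [Ring D] [Algebra K D] {α₁ α₂ α₃ : K}
    {s : Gen → D} (h : QuadRel α₁ α₂ (s .a) (s .b) (s .c) (s .d))
    (hs : Algebra.adjoin K (Set.range s) = ⊤) {y : D}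
    (hy : y = s .a * s .c + s .c * s .b + s .b * s .a - α₂ • 1) (hy3 : y ^ 3 = α₃ • 1) :
    ⊤ ≤ Submodule.span K (Set.range (mon (s .a) (s .b) (s .c) (s .d) y)) := by
  have hX : Set.range s = {s .a, s .b, s .c, s .d} := by
    ext x
    constructor
    · rintro ⟨z, rfl⟩
      cases z <;> simp
    · rintro (rfl | rfl | rfl | rfl) <;> exact ⟨_, rfl⟩
  have h1 := h.adjoin_le_span hy hy3
  rw [← hX, hs, Algebra.top_toSubmodule] at h1
  refine h1.trans (Submodule.span_mono ?_)
  rintro _ ⟨p, rfl⟩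
  exact ⟨_, (nested_mon_eq _ _ _ _ _ p).symm⟩

/-! ### The grading and the Hilbert series of `B` -/

variable (K)

/-- The element `ac + cb + ba` of `B`. -/
noncomputable def yB : B K :=
  bgen K .a * bgen K .c + bgen K .c * bgen K .b + bgen K .b * bgen K .a

/-- The PBW monomials of `B`. -/
noncomputable def bmon (p : Idx) : B K :=
  mon (bgen K .a) (bgen K .b) (bgen K .c) (bgen K .d) (yB K) p

theorem yB_eq : yB K = bgen K .a * bgen K .c + bgen K .c * bgen K .b + bgen K .b * bgen K .a
    - (0 : K) • 1 := by rw [zero_smul, sub_zero, yB]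

theorem linearIndependent_bmon : LinearIndependent K (bmon K) := by
  have h := linearIndependent_mon_of_hom (K := K) (α₁ := 0) (α₂ := 0) (α₃ := 0) (bgen K)
    (fun R _ _ t ht h3 => exists_bHom ht (by rw [sum_pow_six ht, h3, zero_smul]))
  rw [← yB_eq] at h
  exact h

theorem span_bmon : ⊤ ≤ Submodule.span K (Set.range (bmon K)) := by
  refine (quadRel_bgen K).span_mon_eq_top (α₃ := 0) (adjoin_bgen K) (yB_eq K) ?_
  rw [yB_eq, ← sum_pow_six (quadRel_bgen K), bgen_sum_pow_six, zero_smul]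

/-- The PBW basis of `B`. -/
noncomputable def bbasis : Module.Basis Idx K (B K) :=
  .mk (linearIndependent_bmon K) (span_bmon K)

@[simp]
theorem bbasis_apply (p : Idx) : bbasis K p = bmon K p := Module.Basis.mk_apply _ _ p

theorem yB_mem : yB K ∈ wordsEq K (bgen K) 2 := by
  have h (x z : Gen) : bgen K x * bgen K z ∈ wordsEq K (bgen K) 2 :=
    wordsEq_mul_mem (i := 1) (j := 1) (gen_mem_wordsEq x) (gen_mem_wordsEq z)
  rw [yB]
  exact Submodule.add_mem _ (Submodule.add_mem _ (h _ _) (h _ _)) (h _ _)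

theorem bmon_mem (p : Idx) : bmon K p ∈ bdeg K (deg p) :=
  mon_mem_wordsEq K (gen_mem_wordsEq Gen.a) (gen_mem_wordsEq Gen.b) (gen_mem_wordsEq Gen.c)
    (gen_mem_wordsEq Gen.d) (yB_mem K) p

open Polynomial in
/-- The grading of `B` as a homomorphism to polynomials, with `z ↦ z tⁿ` in degree `n`. -/
theorem exists_coaction : ∃ ψ : B K →ₐ[K] (B K)[X], ∀ n, ∀ z ∈ bdeg K n, ψ z = monomial n z := by
  have h := quadRel_bgen K
  obtain ⟨ψ, hψ⟩ := exists_bHom (K := K) (s := fun z => monomial 1 (bgen K z)) (by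
    refine ⟨⟨?_, ?_, ?_, ?_⟩, ?_, ?_, ?_, ?_⟩ <;>
      simp [monomial_mul_monomial, h.aa, h.bb, h.cc, h.dd, h.ca, h.da, h.db, h.dc]
    all_goals abel) (by
    rw [← map_add, ← map_add, monomial_pow, bgen_sum_pow_six, map_zero])
  refine ⟨ψ, fun n z hz => ?_⟩
  induction hz using Submodule.span_induction with
  | mem z hz =>
    obtain ⟨l, rfl, rfl⟩ := hz
    induction l with
    | nil => simp
    | cons x l ih => simp [ih, hψ, monomial_mul_monomial, add_comm]
  | zero => simp
  | add z z' _ _ h h' => rw [map_add, map_add, h, h']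
  | smul r z _ h => rw [map_smul, h, smul_monomial]

theorem isInternal_bdeg : DirectSum.IsInternal (bdeg K) := by
  obtain ⟨ψ, hψ⟩ := exists_coaction K
  constructor
  · have key (x : DirectSum ℕ fun n => bdeg K n) (n : ℕ) :
        (ψ (DirectSum.coeAddMonoidHom (bdeg K) x)).coeff n = x n := by
      induction x using DirectSum.induction_on with
      | zero => simp
      | of m z =>
        rw [DirectSum.coeAddMonoidHom_of, hψ m z z.2, Polynomial.coeff_monomial,
          DirectSum.coe_of_apply]
        split_ifs <;> rfl
      | add x x' h h' => simp [h, h']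
    intro x x' h
    ext n
    rw [← key, h, key]
  · intro z
    refine ⟨∑ p, DirectSum.of (fun n => bdeg K n) (deg p)
      ⟨(bbasis K).repr z p • bmon K p, Submodule.smul_mem _ _ (bmon_mem K p)⟩, ?_⟩
    rw [map_sum]
    simp only [DirectSum.coeAddMonoidHom_of]
    simpa using (bbasis K).sum_repr z

theorem eq_sum_of_mem_bdeg {n : ℕ} {z : B K} (hz : z ∈ bdeg K n) :
    z = ∑ p with deg p = n, (bbasis K).repr z p • bmon K p := by
  obtain ⟨ψ, hψ⟩ := exists_coaction K
  have h := congrArg ψ ((bbasis K).sum_repr z)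
  rw [hψ n z hz, map_sum] at h
  replace h := congrArg (fun q => q.coeff n) h
  simp only [map_smul, bbasis_apply, hψ _ _ (bmon_mem K _), Polynomial.finsetSum_coeff,
    Polynomial.coeff_smul, Polynomial.coeff_monomial, if_true] at h
  rw [← h, Finset.sum_filter]
  refine Finset.sum_congr rfl fun p _ => ?_
  split_ifs <;> simp_all

theorem finrank_bdeg (n : ℕ) :
    Module.finrank K (bdeg K n) = (Finset.univ.filter fun p : Idx => deg p = n).card := by
  have h : bdeg K n = Submodule.span K (Set.range fun p : {p : Idx // deg p = n} => bmon K p) := by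
    apply le_antisymm
    · intro z hz
      rw [eq_sum_of_mem_bdeg K hz]
      refine sum_mem fun p hp => Submodule.smul_mem _ _ (Submodule.subset_span ⟨⟨p, ?_⟩, rfl⟩)
      simpa using hp
    · rw [Submodule.span_le]
      rintro _ ⟨⟨p, rfl⟩, rfl⟩
      exact bmon_mem K p
  have hli := (linearIndependent_bmon K).comp (Subtype.val : {p : Idx // deg p = n} → Idx)
    Subtype.val_injective
  rw [h, ← Fintype.card_subtype]
  exact finrank_span_eq_card hli

theorem hilbert_series_B :
    (PowerSeries.mk fun n => (Module.finrank K (bdeg K n) : ℤ)) =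
      (1 + PowerSeries.X) ^ 3 * (1 + PowerSeries.X + PowerSeries.X ^ 2) *
        (1 + PowerSeries.X ^ 2 + PowerSeries.X ^ 4) := by
  have h : (PowerSeries.mk fun n => (Module.finrank K (bdeg K n) : ℤ))
      = ∑ p : Idx, PowerSeries.X ^ deg p := by
    ext n
    simp [finrank_bdeg, PowerSeries.coeff_X_pow, eq_comm]
  rw [h]
  simp only [deg, pow_add, pow_mul, Fintype.sum_prod_type, ← Finset.mul_sum, ← Finset.sum_mul,
    Fin.sum_univ_two, Fin.sum_univ_three]
  simp
  ring

theorem finrank_B : Module.finrank K (B K) = 72 := by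
  rw [Module.finrank_eq_card_basis (bbasis K)]
  rfl

end Tetra

/-! ### The isomorphism of `gr T` with `B` -/

namespace Tetra

section Deformation
open AlgFiltration
variable {K D : Type*} [Field K] [Ring D] [Algebra K D] {α₁ α₂ α₃ : K} {s : Gen → D}

/-- `D` is generated by elements `s a, s b, s c, s d` that satisfy the defining relations of
`T(α₁, α₂, α₃)`. -/
structure IsTetra (α₁ α₂ α₃ : K) (s : Gen → D) : Prop where
  adjoin_eq_top : Algebra.adjoin K (Set.range s) = ⊤
  quadRel : QuadRel α₁ α₂ (s .a) (s .b) (s .c) (s .d)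
  cube : (s .a * s .c + s .c * s .b + s .b * s .a - α₂ • 1) ^ 3 = α₃ • 1

/-- The PBW monomials in the generators `s`. -/
def tmon (α₂ : K) (s : Gen → D) (p : Idx) : D :=
  mon (s .a) (s .b) (s .c) (s .d) (s .a * s .c + s .c * s .b + s .b * s .a - α₂ • 1) p

namespace IsTetra

/-- The filtration of `D` by word length in the generators. -/
def filt (H : IsTetra α₁ α₂ α₃ s) : AlgFiltration K D := wordFiltration s H.adjoin_eq_top

/-- A homomorphism `B → gr D` that sends each generator to the class of the corresponding
generator of `D`. -/
def IsGrHom (H : IsTetra α₁ α₂ α₃ s) (φ : B K →ₐ[K] H.filt.gr) : Prop :=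
  ∀ z, H.filt.IsSymb 1 (s z) (φ (bgen K z))

theorem word_mem_filt (H : IsTetra α₁ α₂ α₃ s) (l : List Gen) {n : ℕ} (hl : l.length ≤ n) :
    (l.map s).prod ∈ H.filt.F n :=
  Submodule.subset_span ⟨l, hl, rfl⟩

theorem gen_mem_filt (H : IsTetra α₁ α₂ α₃ s) (z : Gen) : s z ∈ H.filt.F 1 := by
  simpa using H.word_mem_filt [z] le_rfl

theorem smul_one_mem_filt (H : IsTetra α₁ α₂ α₃ s) (r : K) (n : ℕ) : r • 1 ∈ H.filt.F n :=
  Submodule.smul_mem _ r (H.filt.mono (Nat.zero_le n) H.filt.one_mem)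

theorem y_mem_filt (H : IsTetra α₁ α₂ α₃ s) :
    s .a * s .c + s .c * s .b + s .b * s .a - α₂ • 1 ∈ H.filt.F 2 := by
  have hm (x z : Gen) : s x * s z ∈ H.filt.F 2 :=
    H.filt.mul_mem (i := 1) (j := 1) (H.gen_mem_filt x) (H.gen_mem_filt z)
  exact sub_mem (add_mem (add_mem (hm _ _) (hm _ _)) (hm _ _)) (H.smul_one_mem_filt _ _)

theorem sum_pow_six_mem_filt (H : IsTetra α₁ α₂ α₃ s) :
    (s .a + s .b + s .c) ^ 6 ∈ H.filt.F 5 := by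
  have h3 := H.cube
  have hy := H.y_mem_filt
  rw [show 6 = 2 * 3 from rfl, pow_mul, H.quadRel.sum_sq]
  generalize s .a * s .c + s .c * s .b + s .b * s .a - α₂ • 1 = y at h3 hy ⊢
  generalize 3 * α₁ + 2 * α₂ = r
  have hyy := H.filt.mul_mem hy hy
  have e : (y + r • 1) ^ 3
      = (α₃ + r ^ 3) • 1 + (3 * r) • (y * y) + (3 * r ^ 2) • y := by
    rw [add_smul, ← h3]
    simp only [pow_succ, pow_zero, one_mul, mul_add, add_mul, smul_mul_assoc, mul_smul_comm,
      mul_one]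
    module
  rw [e]
  refine add_mem (add_mem (H.smul_one_mem_filt _ _) ?_) ?_
  · exact Submodule.smul_mem _ _ (H.filt.mono (by norm_num) hyy)
  · exact Submodule.smul_mem _ _ (H.filt.mono (by norm_num) hy)

theorem exists_isGrHom (H : IsTetra α₁ α₂ α₃ s) : ∃ φ : B K →ₐ[K] H.filt.gr, H.IsGrHom φ := by
  have h := H.quadRel
  let t (z : Gen) : H.filt.gr := H.filt.symb 1 ⟨_, H.gen_mem_filt z⟩
  have ht (z) : H.filt.IsSymb 1 (s z) (t z) := ⟨_, rfl⟩
  have hmul (x z) : H.filt.IsSymb 2 (s x * s z) (t x * t z) :=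
    IsSymb.mul (m := 1) (n := 1) (ht x) (ht z)
  have hlow (r : K) : r • 1 ∈ H.filt.low 2 := H.smul_one_mem_filt r 1
  suffices ∃ φ : B K →ₐ[K] H.filt.gr, ∀ z, φ (bgen K z) = t z by
    obtain ⟨φ, hφ⟩ := this
    exact ⟨φ, fun z => by rw [hφ]; exact ht z⟩
  refine exists_bHom_of_semiring ?_ ?_ ?_ ?_ ?_ ?_
  · intro z
    refine (hmul z z).eq_zero ?_
    cases z
    · rw [h.aa]; exact hlow _
    · rw [h.bb]; exact hlow _
    · rw [h.cc]; exact hlow _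
    · rw [h.dd]; exact hlow _
  · refine (((hmul _ _).add (hmul _ _)).add (hmul _ _)).eq_zero ?_
    rw [h.ca]
    convert hlow α₂ using 1
    abel
  · refine (((hmul _ _).add (hmul _ _)).add (hmul _ _)).eq_zero ?_
    rw [h.da]
    convert hlow α₂ using 1
    abel
  · refine (((hmul _ _).add (hmul _ _)).add (hmul _ _)).eq_zero ?_
    rw [h.db]
    convert hlow α₂ using 1
    abel
  · refine (((hmul _ _).add (hmul _ _)).add (hmul _ _)).eq_zero ?_
    rw [h.dc]
    convert hlow α₂ using 1
    abel
  · have h6 := (((ht .a).add (ht .b)).add (ht .c)).pow 6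
    rw [one_mul] at h6
    exact h6.eq_zero H.sum_pow_six_mem_filt

namespace IsGrHom
variable {H : IsTetra α₁ α₂ α₃ s} {φ : B K →ₐ[K] H.filt.gr}

theorem isSymb_word (hφ : H.IsGrHom φ) (l : List Gen) : H.filt.IsSymb l.length
    (l.map s).prod (φ (l.map (bgen K)).prod) := by
  induction l with
  | nil => simpa using IsSymb.one
  | cons x l ih =>
    simp only [List.map_cons, List.prod_cons, map_mul, List.length_cons]
    rw [add_comm]
    exact (hφ x).mul ih

theorem isSymb_tmon (hφ : H.IsGrHom φ) (p : Idx) :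
    H.filt.IsSymb (deg p) (tmon α₂ s p) (φ (bmon K p)) := by
  have hmul (x z) : H.filt.IsSymb 2 (s x * s z) (φ (bgen K x * bgen K z)) := by
    rw [map_mul]
    exact IsSymb.mul (m := 1) (n := 1) (hφ x) (hφ z)
  have hy : H.filt.IsSymb 2 (s .a * s .c + s .c * s .b + s .b * s .a - α₂ • 1) (φ (yB K)) := by
    rw [yB_eq]
    refine IsSymb.sub φ.toLinearMap ?_ ?_
    · simp only [AlgHom.toLinearMap_apply]
      rw [map_add, map_add]
      exact ((hmul _ _).add (hmul _ _)).add (hmul _ _)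
    · rw [zero_smul, map_zero]
      exact isSymb_zero_of_mem_low (H.smul_one_mem_filt _ 1)
  have hba : H.filt.IsSymb 1 (s .b - s .a) (φ (bgen K .b - bgen K .a)) :=
    IsSymb.sub φ.toLinearMap (hφ .b) (hφ .a)
  have h := ((((hba.pow p.1).mul ((hφ .a).pow p.2.1)).mul ((hφ .c).pow p.2.2.1)).mul
    (hy.pow p.2.2.2.1)).mul ((hφ .d).pow p.2.2.2.2)
  simp only [one_mul, ← map_mul, ← map_pow] at h
  exact h

theorem exists_isSymb_of_mem_bdeg (hφ : H.IsGrHom φ) {n : ℕ} {z : B K} (hz : z ∈ bdeg K n) :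
    ∃ x ∈ Submodule.span K (tmon α₂ s '' {p | deg p ≤ n}), H.filt.IsSymb n x (φ z) := by
  refine ⟨∑ p with deg p = n, (bbasis K).repr z p • tmon α₂ s p, ?_, ?_⟩
  · refine sum_mem fun p hp => Submodule.smul_mem _ _ (Submodule.subset_span ⟨p, ?_, rfl⟩)
    rw [Finset.mem_filter] at hp
    exact hp.2.le
  · have h : φ z = ∑ p with deg p = n, (bbasis K).repr z p • φ (bmon K p) := by
      conv_lhs => rw [eq_sum_of_mem_bdeg K hz]
      rw [map_sum]
      exact Finset.sum_congr rfl fun p _ => map_smul φ _ _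
    rw [h]
    refine IsSymb.sum _ fun p hp => ?_
    obtain rfl := (Finset.mem_filter.1 hp).2
    exact (hφ.isSymb_tmon p).smul _

/-- `φ` is surjective in each degree, and on the elements of `F n` it intertwines every pair of
endomorphisms of `B` and `D` that permute the generators in the same way, up to a common scalar. -/
theorem exists_isSymb_and_map (hφ : H.IsGrHom φ) {τB : B K →ₐ[K] B K} {τ : D →ₐ[K] D}
    {π : Gen → Gen} {ε : K} (hB : ∀ z, τB (bgen K z) = ε • bgen K (π z))
    (hτ : ∀ z, τ (s z) = ε • s (π z)) {n : ℕ} {x : D} (hx : x ∈ H.filt.F n) :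
    ∃ z ∈ bdeg K n, H.filt.IsSymb n x (φ z) ∧ H.filt.IsSymb n (τ x) (φ (τB z)) := by
  change x ∈ wordsLE K s n at hx
  induction hx using Submodule.span_induction with
  | mem x hx =>
    obtain ⟨l, hl, rfl⟩ := hx
    have hw := map_word (φ := τ) hτ l
    rcases hl.eq_or_lt with rfl | hlt
    · refine ⟨_, word_mem_wordsEq l, hφ.isSymb_word l, ?_⟩
      rw [hw, map_word (φ := τB) hB l, map_smul]
      have h := hφ.isSymb_word (l.map π)
      rw [List.length_map] at h
      exact h.smul _
    · refine ⟨0, zero_mem _, ?_, ?_⟩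
      · rw [map_zero]
        exact isSymb_zero_of_mem_low (le_low hlt (H.word_mem_filt _ le_rfl))
      · rw [map_zero, map_zero, hw]
        refine isSymb_zero_of_mem_low (le_low hlt ?_)
        exact Submodule.smul_mem _ _ (H.word_mem_filt _ (List.length_map _).le)
  | zero =>
    refine ⟨0, zero_mem _, ?_, ?_⟩ <;> simp only [map_zero] <;>
      exact isSymb_zero_of_mem_low (zero_mem _)
  | add x x' _ _ h h' =>
    obtain ⟨z, hz, h1, h2⟩ := h
    obtain ⟨z', hz', h1', h2'⟩ := h'
    refine ⟨z + z', add_mem hz hz', ?_, ?_⟩ <;> simp only [map_add]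
    · exact h1.add h1'
    · exact h2.add h2'
  | smul r x _ h =>
    obtain ⟨z, hz, h1, h2⟩ := h
    refine ⟨r • z, Submodule.smul_mem _ _ hz, ?_, ?_⟩ <;> simp only [map_smul]
    · exact h1.smul r
    · exact h2.smul r

theorem exists_isSymb_of_mem_filt (hφ : H.IsGrHom φ) {n : ℕ} {x : D} (hx : x ∈ H.filt.F n) :
    ∃ z ∈ bdeg K n, H.filt.IsSymb n x (φ z) := by
  obtain ⟨z, hz, h, _⟩ := hφ.exists_isSymb_and_map (τB := .id K _) (τ := .id K _) (π := id)
    (ε := 1) (by simp) (by simp) hx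
  exact ⟨z, hz, h⟩

theorem surjective (hφ : H.IsGrHom φ) : Function.Surjective φ := by
  intro u
  induction u using gr_induction with
  | h0 => exact ⟨0, map_zero φ⟩
  | hadd u v hu hv =>
    obtain ⟨z, rfl⟩ := hu
    obtain ⟨z', rfl⟩ := hv
    exact ⟨z + z', map_add φ z z'⟩
  | hsymb n x u hu =>
    obtain ⟨z, -, hz⟩ := hφ.exists_isSymb_of_mem_filt hu.1
    exact ⟨z, hz.unique hu⟩

/-- The symbol of `x ∈ F n` is that of a combination of monomials of degree `n`, so induction on `n`
applies to the difference. -/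
theorem filt_le_span (hφ : H.IsGrHom φ) (n : ℕ) :
    H.filt.F n ≤ Submodule.span K (tmon α₂ s '' {p | deg p ≤ n}) := by
  have step (n : ℕ) (hlow : H.filt.low n ≤ Submodule.span K (tmon α₂ s '' {p | deg p ≤ n})) :
      H.filt.F n ≤ Submodule.span K (tmon α₂ s '' {p | deg p ≤ n}) := by
    intro x hx
    obtain ⟨z, hz, h⟩ := hφ.exists_isSymb_of_mem_filt hx
    obtain ⟨x', hx', h'⟩ := hφ.exists_isSymb_of_mem_bdeg hz
    have h0 := IsSymb.sub φ.toLinearMap h h'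
    rw [sub_self, map_zero] at h0
    rw [← sub_add_cancel x x']
    exact add_mem (hlow h0.mem_low) hx'
  induction n with
  | zero => exact step 0 bot_le
  | succ n ih =>
    refine step _ (ih.trans (Submodule.span_mono (Set.image_mono fun p hp => ?_)))
    exact le_trans (Set.mem_ofPred.1 hp) n.le_succ

theorem coord_eq_zero (hφ : H.IsGrHom φ) (β : Module.Basis Idx K D)
    (hβ : ∀ p, β p = tmon α₂ s p) {n : ℕ} {x : D} (hx : x ∈ H.filt.F n) {q : Idx} (hq : n < deg q) :
    β.coord q x = 0 := by
  have h : Submodule.span K (tmon α₂ s '' {p | deg p ≤ n}) ≤ LinearMap.ker (β.coord q) := by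
    rw [Submodule.span_le]
    rintro _ ⟨p, hp, rfl⟩
    rw [SetLike.mem_coe, LinearMap.mem_ker, ← hβ, Module.Basis.coord_apply,
      Module.Basis.repr_self]
    refine Finsupp.single_eq_of_ne ?_
    rintro rfl
    exact absurd hp (not_le.2 hq)
  exact h (hφ.filt_le_span n hx)

theorem injective (hφ : H.IsGrHom φ) (β : Module.Basis Idx K D) (hβ : ∀ p, β p = tmon α₂ s p) :
    Function.Injective φ := by
  rw [injective_iff_map_eq_zero]
  intro z hz
  rw [← (bbasis K).sum_repr z]
  refine Finset.sum_eq_zero fun q _ => ?_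
  -- the coefficient of the monomial `q` can be read off from the image in `gr D`
  obtain ⟨L, hL⟩ := exists_linearMap_gr (f := H.filt) (deg q) (β.coord q) (by
    intro x hx
    rcases h : deg q with _ | n
    · rw [h] at hx
      rw [show x = 0 from hx, map_zero]
    · rw [h] at hx
      exact hφ.coord_eq_zero β hβ (show x ∈ H.filt.F n from hx) (by omega))
  have h1 := congrArg (fun u => L (φ u)) ((bbasis K).sum_repr z)
  simp only [hz, map_sum, map_smul, bbasis_apply, hL _ _ _ (hφ.isSymb_tmon _), map_zero] at h1
  have h2 (p : Idx) : (if deg p = deg q then β.coord q (tmon α₂ s p) else 0)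
      = if p = q then 1 else 0 := by
    rw [← hβ, Module.Basis.coord_apply, Module.Basis.repr_self, Finsupp.single_apply]
    split_ifs <;> simp_all
  simp only [h2] at h1
  simp at h1
  rw [h1, zero_smul]

end IsGrHom

theorem span_tmon (H : IsTetra α₁ α₂ α₃ s) : ⊤ ≤ Submodule.span K (Set.range (tmon α₂ s)) :=
  H.quadRel.span_mon_eq_top H.adjoin_eq_top rfl H.cube

theorem isPBWDeformation (H : IsTetra α₁ α₂ α₃ s) (hli : LinearIndependent K (tmon α₂ s))
    {ρB : G →* (B K ≃ₐ[K] B K)} {ρ : G →* (D ≃ₐ[K] D)}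
    (hB : ∀ x z, ρB (g x) (bgen K z) = -bgen K (op x z))
    (hρ : ∀ x z, ρ (g x) (s z) = -s (op x z)) :
    IsPBWDeformation ρB (bdeg K) ρ H.filt := by
  obtain ⟨φ, hφ⟩ := H.exists_isGrHom
  let e := AlgEquiv.ofBijective φ
    ⟨hφ.injective (.mk hli H.span_tmon) (Module.Basis.mk_apply _ _), hφ.surjective⟩
  have he (z : B K) : e.symm (φ z) = z := e.symm_apply_apply z
  have key (w : G) {n : ℕ} {x : D} (hx : x ∈ H.filt.F n) : ∃ z ∈ bdeg K n,
      H.filt.IsSymb n x (φ z) ∧ H.filt.IsSymb n (ρ w x) (φ (ρB w z)) := by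
    obtain ⟨π, ε, hπB, hπ⟩ := exists_perm_sign hB hρ w
    exact hφ.exists_isSymb_and_map (τB := (ρB w).toAlgHom) (τ := (ρ w).toAlgHom) hπB hπ hx
  refine ⟨⟨{ one_mem := one_mem_wordsEq, mul_mem := fun _ _ _ _ => wordsEq_mul_mem },
    isInternal_bdeg K, ?_⟩, ?_, e.symm, fun n => ?_, ?_⟩
  · intro w n z hz
    obtain ⟨π, ε, hπ, -⟩ := exists_perm_sign hB hρ w
    change z ∈ wordsEq K (bgen K) n at hz
    induction hz using Submodule.span_induction with
    | mem z hz =>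
      obtain ⟨l, rfl, rfl⟩ := hz
      rw [map_word (φ := ρB w) hπ l]
      exact Submodule.smul_mem _ _ (Submodule.subset_span ⟨_, List.length_map _, rfl⟩)
    | zero => rw [map_zero]; exact zero_mem _
    | add z z' _ _ h h' => rw [map_add]; exact add_mem h h'
    | smul r z _ h => rw [map_smul]; exact Submodule.smul_mem _ _ h
  · intro w n x hx
    obtain ⟨z, -, -, h⟩ := key w hx
    exact h.1
  · ext z
    simp only [Submodule.mem_map, LinearMap.mem_range]
    constructor
    · rintro ⟨_, ⟨x, rfl⟩, rfl⟩
      obtain ⟨z, hz, h⟩ := hφ.exists_isSymb_of_mem_filt x.2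
      rw [(isSymb_symb x).unique h]
      exact (he z).symm ▸ hz
    · intro hz
      obtain ⟨x, -, hx, h⟩ := hφ.exists_isSymb_of_mem_bdeg hz
      exact ⟨_, ⟨⟨x, hx⟩, h⟩, he z⟩
  · intro w n x hx
    obtain ⟨z, -, ⟨_, h1⟩, ⟨_, h2⟩⟩ := key w hx
    rw [h1, h2, he, he]

end IsTetra

theorem isTetra_tgen (α₁ α₂ α₃ : K) : IsTetra α₁ α₂ α₃ (tgen α₁ α₂ α₃) :=
  ⟨adjoin_tgen α₁ α₂ α₃, quadRel_tgen α₁ α₂ α₃, by rw [← y_eq, y_pow_three]⟩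

theorem linearIndependent_tmon (α₁ α₂ α₃ : K) :
    LinearIndependent K (tmon α₂ (tgen α₁ α₂ α₃)) :=
  linearIndependent_mon_of_hom (tgen α₁ α₂ α₃) (fun _ _ _ _ ht h3 => exists_tHom ht h3)

end Deformation
end Tetra

theorem mainTheorem4 (K : Type*) [Field K] [IsAlgClosed K]
    (h2 : ringChar K ≠ 2) (h3 : ringChar K ≠ 3) :
    (∀ α₁ α₂ α₃ : K,
      (∃ (ρB : Tetra.G →* (Tetra.B K ≃ₐ[K] Tetra.B K))
          (ρT : Tetra.G →* (Tetra.T α₁ α₂ α₃ ≃ₐ[K] Tetra.T α₁ α₂ α₃)),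
        (∀ x z : Tetra.Gen,
          ρB (Tetra.g x) (Tetra.bgen K z) = -Tetra.bgen K (Tetra.op x z)) ∧
        (∀ x z : Tetra.Gen,
          ρT (Tetra.g x) (Tetra.tgen α₁ α₂ α₃ z) = -Tetra.tgen α₁ α₂ α₃ (Tetra.op x z)) ∧
        IsPBWDeformation ρB (Tetra.bdeg K) ρT (Tetra.tfilt α₁ α₂ α₃)) ∧
      (∃ β : Module.Basis (Fin 3 × Fin 2 × Fin 2 × Fin 3 × Fin 2) K (Tetra.T α₁ α₂ α₃),
        ∀ (n₁ : Fin 3) (n₂ n₃ : Fin 2) (n₄ : Fin 3) (n₅ : Fin 2),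
          β (n₁, n₂, n₃, n₄, n₅) =
            (Tetra.tgen α₁ α₂ α₃ .b - Tetra.tgen α₁ α₂ α₃ .a) ^ (n₁ : ℕ) *
              Tetra.tgen α₁ α₂ α₃ .a ^ (n₂ : ℕ) * Tetra.tgen α₁ α₂ α₃ .c ^ (n₃ : ℕ) *
              Tetra.y α₁ α₂ α₃ ^ (n₄ : ℕ) * Tetra.tgen α₁ α₂ α₃ .d ^ (n₅ : ℕ))) ∧
    Module.finrank K (Tetra.B K) = 72 ∧
    (PowerSeries.mk fun n => (Module.finrank K (Tetra.bdeg K n) : ℤ)) =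
      (1 + PowerSeries.X) ^ 3 * (1 + PowerSeries.X + PowerSeries.X ^ 2) *
        (1 + PowerSeries.X ^ 2 + PowerSeries.X ^ 4) := by
  refine ⟨fun α₁ α₂ α₃ => ⟨?_, .mk (Tetra.linearIndependent_tmon α₁ α₂ α₃)
    (Tetra.isTetra_tgen α₁ α₂ α₃).span_tmon, fun n₁ n₂ n₃ n₄ n₅ => ?_⟩,
    Tetra.finrank_B K, Tetra.hilbert_series_B K⟩
  · obtain ⟨ρB, hB⟩ := Tetra.exists_action_B K
    obtain ⟨ρT, hT⟩ := Tetra.exists_action_T α₁ α₂ α₃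
    exact ⟨ρB, ρT, hB, hT, (Tetra.isTetra_tgen α₁ α₂ α₃).isPBWDeformation
      (Tetra.linearIndependent_tmon α₁ α₂ α₃) hB hT⟩
  · rw [Module.Basis.mk_apply, Tetra.y_eq]
    rfl
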